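/- Let $\mathbb K$ be a field of characteristic $0$, let $\alpha,\beta\in\mathbb K$, and suppose that $t^2-\alpha t-\beta=(t-r_1)(t-r_2)$ with $r_1,r_2\in\mathbb K$. Assume that $\beta\neq 0$ (that is, $r_1,r_2\ne0$) and that $r_1^ir_2^j\neq 1$ for all integers $i,j$ with $(i,j)\neq(0,0)$. Let $$A=A(\alpha,\beta,0)=\mathbb K\langle u,d\rangle/(d^2u-\alpha dud-\beta ud^2,\ du^2-\alpha udu-\beta u^2d)$$ be the corresponding down-up algebra, bigraded by $\operatorname{bideg}(u)=(1,1)$ and $\operatorname{bideg}(d)=(1,-1)$, and put $w_1=\beta ud+r_1du\in A$. Let $V$ have basis $\{d,u\}$, $R\subset V^{\otimes3}$ have basis $\{d^2u,du^2\}$ and $\Omega\subset V^{\otimes 4}$ have basis $\{d^2u^2\}$; denote the dual bases by $\{D,U\}$, $\{D^2U,DU^2\}$, $\{D^2U^2\}$, and write $\xi|a$ for $\xi\otimes a$. The Hochschild cohomology of $A$ is computed by the complex $0\to A\xrightarrow{d_0^*}V^*\otimes A\xrightarrow{d_1^*}R^*\otimes A\xrightarrow{d_2^*}\Omega^*\otimes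 A\to0$ in which $d_0^*(a)=U|(ua-au)+D|(da-ad)$, $$d_1^*(U|a+D|a')=D^2U|\Delta_1+DU^2|\Delta_2,$$ $$\Delta_1=d^2a+a'du+da'u-\alpha(dad+a'ud+dua')-\beta(ad^2+ua'd+uda'),$$ $$\Delta_2=dau+dua+a'u^2-\alpha(adu+uda+ua'u)-\beta(aud+uad+u^2a'),$$ $$d_2^*(D^2U|a+DU^2|a')=D^2U^2|(da'+\beta a'd-au-\beta ua),$$ bigraded by $\operatorname{bideg}(U)=(-1,-1)$, $\operatorname{bideg}(D)=(-1,1)$, so that $D^2U$ and $DU^2$ have bidegrees $(-3,1)$ and $(-3,-1)$. The identification of $HH^2(A)$ (Hochschild $2$-cocycles modulo coboundaries) with $\operatorname{Ker}(d_2^*)/\operatorname{Im}(d_1^*)$ is induced by the map sending a bilinear cocycle $f$ to $D^2U|f_1+DU^2|f_2$, where $f_1$ and $f_2$ are obtained from the relations $d^2u-\alpha dud-\beta ud^2$ and $du^2-\alpha udu-\beta u^2d$ by replacing each word $xyz$ by $f(x,yz)+x\,f(y,z)$. The component of $HH^2(A)$ of bidegree $(n,s)$ consists of the classes of the cocycles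 that raise the bidegree by $(n,s)$. Let $k\geq 1$. Then the homogeneous component of $\operatorname{Ker}(d_2^*)$ of bidegree $(2k,0)$ is the $\mathbb K$-vector space of dimension $k+2$ spanned by the set $$\{D^2U|u^aw_1^{k+1-a}d^{a+1}+DU^2|u^{a+1}w_1^{k+1-a}d^a : 0\leq a\leq k+1\}.$$ Moreover, the homogeneous component of bidegree $(2k,0)$ of $\operatorname{Ker}(d_2^*)/\operatorname{Im}(d_1^*)$ is one-dimensional, generated by the class of $D^2U|w_1^{k+1}d+DU^2|uw_1^{k+1}$; there is exactly one class in $HH^2(A)$ that corresponds to it under the above map, and that class generates the homogeneous component of $HH^2(A)$ of bidegree $(2k,0)$, which is one-dimensional. -/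

import Mathlib

set_option maxSynthPendingDepth 3

/-! ### Hochschild cohomology in degree two, by Hochschild cochains -/

namespace Hochschild

section
variable (K A : Type*) [Field K] [Ring A] [Algebra K A]

/-- Hochschild `2`-cochains of `A` with coefficients in `A`, i.e. bilinear maps `A × A → A`. -/
abbrev Cochain2 := A →ₗ[K] A →ₗ[K] A

/-- Hochschild `2`-cocycles. -/
def Z2 : Submodule K (Cochain2 K A) where
  carrier := {f | ∀ a b c : A, a * f b c - f (a * b) c + f a (b * c) - f a b * c = 0}
  add_mem' := by
    intro f g hf hg a b c
    have h := congrArg₂ (· + ·) (hf a b c) (hg a b c)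
    simp only [add_zero] at h
    rw [← h]
    simp only [LinearMap.add_apply, mul_add, add_mul]
    abel
  zero_mem' := by intro a b c; simp
  smul_mem' := by
    intro t f hf a b c
    have h := congrArg (t • ·) (hf a b c)
    simp only [smul_zero] at h
    rw [← h]
    simp only [LinearMap.smul_apply, mul_smul_comm, smul_mul_assoc, smul_sub, smul_add]

/-- Hochschild `2`-coboundaries. -/
def B2 : Submodule K (Cochain2 K A) where
  carrier := {f | ∃ g : A →ₗ[K] A, ∀ a b : A, f a b = a * g b - g (a * b) + g a * b}
  add_mem' := by
    rintro f f' ⟨g, hg⟩ ⟨g', hg'⟩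
    refine ⟨g + g', fun a b => ?_⟩
    simp only [LinearMap.add_apply, hg, hg', mul_add, add_mul]
    abel
  zero_mem' := ⟨0, fun a b => by simp⟩
  smul_mem' := by
    rintro t f ⟨g, hg⟩
    refine ⟨t • g, fun a b => ?_⟩
    simp only [LinearMap.smul_apply, hg, mul_smul_comm, smul_mul_assoc, smul_sub, smul_add]

/-- The second Hochschild cohomology `HH²(A) = HH²(A, A)`: cocycles modulo coboundaries. -/
abbrev HH2 := (Z2 K A) ⧸ (B2 K A).submoduleOf (Z2 K A)

end

end Hochschild

namespace DownUp

open Hochschild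

/-- The two generators `u` (up) and `d` (down). -/
inductive Gen
  | u
  | d
  deriving DecidableEq

section
variable {K : Type*} [Field K]

/-- The defining relations of the down-up algebra `A(α, β, γ)`. -/
inductive Rel (α β γ : K) : FreeAlgebra K Gen → FreeAlgebra K Gen → Prop
  | ddu : Rel α β γ
      (FreeAlgebra.ι K Gen.d * FreeAlgebra.ι K Gen.d * FreeAlgebra.ι K Gen.u)
      (α • (FreeAlgebra.ι K Gen.d * FreeAlgebra.ι K Gen.u * FreeAlgebra.ι K Gen.d)
        + β • (FreeAlgebra.ι K Gen.u * FreeAlgebra.ι K Gen.d * FreeAlgebra.ι K Gen.d)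
        + γ • FreeAlgebra.ι K Gen.d)
  | duu : Rel α β γ
      (FreeAlgebra.ι K Gen.d * FreeAlgebra.ι K Gen.u * FreeAlgebra.ι K Gen.u)
      (α • (FreeAlgebra.ι K Gen.u * FreeAlgebra.ι K Gen.d * FreeAlgebra.ι K Gen.u)
        + β • (FreeAlgebra.ι K Gen.u * FreeAlgebra.ι K Gen.u * FreeAlgebra.ι K Gen.d)
        + γ • FreeAlgebra.ι K Gen.u)

/-- The down-up algebra `A(α, β, γ)`. -/
def Alg (α β γ : K) : Type _ := RingQuot (Rel α β γ)

instance (α β γ : K) : Ring (Alg α β γ) := inferInstanceAs (Ring (RingQuot (Rel α β γ)))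

instance (α β γ : K) : Algebra K (Alg α β γ) :=
  inferInstanceAs (Algebra K (RingQuot (Rel α β γ)))

/-- The quotient map from the free algebra on `u` and `d`. -/
def proj (α β γ : K) : FreeAlgebra K Gen →ₐ[K] Alg α β γ := RingQuot.mkAlgHom K (Rel α β γ)

variable (α β γ : K)

/-- The image of a generator in the down-up algebra. -/
def gen (g : Gen) : Alg α β γ := proj α β γ (FreeAlgebra.ι K g)

/-- The generator `u` of the down-up algebra. -/
def u : Alg α β γ := gen α β γ Gen.u

/-- The generator `d` of the down-up algebra. -/
def d : Alg α β γ := gen α β γ Gen.d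

theorem rel_ddu : d α β γ * d α β γ * u α β γ
    = α • (d α β γ * u α β γ * d α β γ) + β • (u α β γ * d α β γ * d α β γ)
      + γ • d α β γ := by
  have h : proj α β γ _ = proj α β γ _ :=
    RingQuot.mkAlgHom_rel K (Rel.ddu (α := α) (β := β) (γ := γ))
  simpa only [u, d, gen, map_mul, map_add, map_smul] using h

theorem rel_duu : d α β γ * u α β γ * u α β γ
    = α • (u α β γ * d α β γ * u α β γ) + β • (u α β γ * u α β γ * d α β γ)
      + γ • u α β γ := by
  have h : proj α β γ _ = proj α β γ _ :=
    RingQuot.mkAlgHom_rel K (Rel.duu (α := α) (β := β) (γ := γ))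
  simpa only [u, d, gen, map_mul, map_add, map_smul] using h

/-- The element `w = β ud + r du`. -/
def w (r : K) : Alg α β γ :=
  β • (u α β γ * d α β γ) + r • (d α β γ * u α β γ)

/-! From here on `γ = 0`, so that `A = A(α, β, 0)` is `ℤ²`-graded by
`(degree, special degree)`, with `u` in bidegree `(1, 1)` and `d` in bidegree `(1, -1)`. -/

/-- The component of `A(α, β, 0)` of bidegree `(n, s)`: the span of the words in `u`, `d` of
length `n` in which the number of `u`'s minus the number of `d`'s is `s`. -/
def component (n s : ℤ) : Submodule K (Alg α β 0) :=
  Submodule.span K {x | ∃ l : List Gen, (l.length : ℤ) = n ∧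
    (l.count Gen.u : ℤ) - (l.count Gen.d : ℤ) = s ∧ x = (l.map (gen α β 0)).prod}

/-- The space `V* ⊗ A`; the pair `(a, a')` is the element `U|a + D|a'`. -/
abbrev C1 := Alg α β 0 × Alg α β 0

/-- The space `R* ⊗ A`; the pair `(a, a')` is the element `D²U|a + DU²|a'`. -/
abbrev C2 := Alg α β 0 × Alg α β 0

/-- The space `Ω* ⊗ A`; the element `a` stands for `D²U²|a`. -/
abbrev C3 := Alg α β 0

/-- The component of bidegree `(n, s)` of `R* ⊗ A`, where `U` and `D` have bidegrees `(-1, -1)`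
and `(-1, 1)`, so that `D²U` and `DU²` have bidegrees `(-3, 1)` and `(-3, -1)`. -/
def C2component (n s : ℤ) : Submodule K (C2 α β) :=
  (component α β (n + 3) (s - 1)).prod (component α β (n + 3) (s + 1))

/-- The differential `d₁* : V* ⊗ A → R* ⊗ A`. -/
def d1 : C1 α β →ₗ[K] C2 α β :=
  let u := u α β 0
  let d := d α β 0
  { toFun := fun x =>
      (d * d * x.1 + x.2 * d * u + d * x.2 * u
          - α • (d * x.1 * d + x.2 * u * d + d * u * x.2)
          - β • (x.1 * d * d + u * x.2 * d + u * d * x.2),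
        d * x.1 * u + d * u * x.1 + x.2 * u * u
          - α • (x.1 * d * u + u * d * x.1 + u * x.2 * u)
          - β • (x.1 * u * d + u * x.1 * d + u * u * x.2))
    map_add' := by
      intro x y
      ext <;> simp only [Prod.fst_add, Prod.snd_add, mul_add, add_mul, smul_add] <;> abel
    map_smul' := by
      intro t x
      ext <;> simp only [Prod.smul_fst, Prod.smul_snd, mul_smul_comm, smul_mul_assoc,
        smul_add, smul_sub, RingHom.id_apply, smul_comm t] }

/-- The differential `d₂* : R* ⊗ A → Ω* ⊗ A`. -/
def d2 : C2 α β →ₗ[K] C3 α β :=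
  let u := u α β 0
  let d := d α β 0
  { toFun := fun x => d * x.2 + β • (x.2 * d) - x.1 * u - β • (u * x.1)
    map_add' := by
      intro x y
      simp only [Prod.fst_add, Prod.snd_add, mul_add, add_mul, smul_add]
      abel
    map_smul' := by
      intro t x
      simp only [Prod.smul_fst, Prod.smul_snd, mul_smul_comm, smul_mul_assoc,
        smul_add, smul_sub, RingHom.id_apply, smul_comm t] }

/-- `Ker(d₂*)`. -/
abbrev Z := LinearMap.ker (d2 α β)

/-- The component of bidegree `(n, s)` of `Ker(d₂*)`. -/
def Zcomponent (n s : ℤ) : Submodule K (C2 α β) := Z α β ⊓ C2component α β n s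

/-- The cohomology `Ker(d₂*) / Im(d₁*)` in degree two of the complex
`A → V* ⊗ A → R* ⊗ A → Ω* ⊗ A`. -/
abbrev H2 := Z α β ⧸ (LinearMap.range (d1 α β)).submoduleOf (Z α β)

/-- The class in `Ker(d₂*) / Im(d₁*)` of an element of `Ker(d₂*)`. -/
def H2class (x : C2 α β) (hx : x ∈ Z α β) : H2 α β := Submodule.Quotient.mk ⟨x, hx⟩

/-- The component of bidegree `(n, s)` of `Ker(d₂*) / Im(d₁*)`. -/
def H2component (n s : ℤ) : Submodule K (H2 α β) :=
  ((C2component α β n s).comap (Z α β).subtype).map (Submodule.mkQ _)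

/-- The component of bidegree `(n, s)` of the Hochschild cohomology `HH²(A)`: the classes of the
cocycles that raise the bidegree by `(n, s)`. -/
def HH2component (n s : ℤ) : Submodule K (HH2 K (Alg α β 0)) :=
  Submodule.map (Submodule.mkQ _)
    { carrier := {f : Z2 K (Alg α β 0) | ∀ p q p' q' : ℤ, ∀ a ∈ component α β p q,
        ∀ b ∈ component α β p' q', f.1 a b ∈ component α β (p + p' + n) (q + q' + s)}
      add_mem' := fun hf hg p q p' q' a ha b hb =>
        Submodule.add_mem _ (hf p q p' q' a ha b hb) (hg p q p' q' a ha b hb)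
      zero_mem' := fun _ _ _ _ _ _ _ _ => Submodule.zero_mem _
      smul_mem' := fun t _ hf p q p' q' a ha b hb =>
        (component α β (p + p' + n) (q + q' + s)).smul_mem t (hf p q p' q' a ha b hb) }

/-- The map from Hochschild `2`-cochains to `R* ⊗ A = Hom(R, A)` dual to the map of `A`-bimodules
`A ⊗ R ⊗ A → A ⊗ A ⊗ A ⊗ A` into the bar resolution that sends a word `xyz` occurring in a
relation to `1 ⊗ x ⊗ yz ⊗ 1 + x ⊗ y ⊗ z ⊗ 1`. -/
def restrict : Cochain2 K (Alg α β 0) →ₗ[K] C2 α β :=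
  let u := u α β 0
  let d := d α β 0
  { toFun := fun f =>
      ((f d (d * u) + d * f d u) - α • (f d (u * d) + d * f u d)
          - β • (f u (d * d) + u * f d d),
        (f d (u * u) + d * f u u) - α • (f u (d * u) + u * f d u)
          - β • (f u (u * d) + u * f u d))
    map_add' := by
      intro x y
      ext <;> simp only [LinearMap.add_apply, Prod.fst_add, Prod.snd_add, mul_add, smul_add]
        <;> abel
    map_smul' := by
      intro t x
      ext <;> simp only [LinearMap.smul_apply, Prod.smul_fst, Prod.smul_snd, mul_smul_comm,
        smul_add, smul_sub, RingHom.id_apply, smul_comm t] }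

theorem restrict_mem_ker (f : Cochain2 K (Alg α β 0)) (hf : f ∈ Z2 K (Alg α β 0)) :
    restrict α β f ∈ Z α β := by
  have hZ : ∀ a b c : Alg α β 0,
    a * f b c - f (a * b) c + f a (b * c) - f a b * c = 0 := hf
  have R1 := rel_ddu α β 0
  have R2 := rel_duu α β 0
  rw [LinearMap.mem_ker]
  change (d α β 0) * (restrict α β f).2 + β • ((restrict α β f).2 * d α β 0)
    - (restrict α β f).1 * u α β 0 - β • (u α β 0 * (restrict α β f).1) = 0
  simp only [restrict, LinearMap.coe_mk, AddHom.coe_mk]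
  generalize u α β 0 = u at *
  generalize d α β 0 = d at *
  have e1 := congrArg (fun x => f x u) R1
  have e2 := congrArg (fun x => f d x) R2
  have e3 := congrArg (fun x => f x d) R2
  have e4 := congrArg (fun x => f u x) R1
  have z1 := congrArg (d * ·) (hZ d u u)
  have z2 := hZ d (d * u) u
  have z3 := congrArg (d * ·) (hZ u d u)
  have z4 := hZ d (u * d) u
  have z5 := congrArg (d * ·) (hZ u u d)
  have z6 := hZ d (u * u) d
  have z7 := congrArg (u * ·) (hZ d d u)
  have z8 := hZ u (d * d) u
  have z9 := congrArg (u * ·) (hZ d u d)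
  have z10 := hZ u (d * u) d
  have z11 := congrArg (u * ·) (hZ u d d)
  have z12 := hZ u (u * d) d
  simp only [zero_smul, add_zero, map_add, map_smul, LinearMap.add_apply, LinearMap.smul_apply,
    mul_add, mul_sub, add_mul, sub_mul, mul_zero, mul_assoc, mul_smul_comm,
    smul_mul_assoc] at *
  linear_combination (norm := module) z1 + z2 - α • z3 - α • z4 - β • z5 - β • z6
    - β • z7 - β • z8 + (α * β) • z9 + (α * β) • z10 + (β * β) • z11 + (β * β) • z12
    + e1 - e2 - β • e3 + β • e4

theorem restrict_mem_range (f : Cochain2 K (Alg α β 0)) (hf : f ∈ B2 K (Alg α β 0)) :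
    restrict α β f ∈ LinearMap.range (d1 α β) := by
  obtain ⟨g, hg⟩ := hf
  refine ⟨(g (u α β 0), g (d α β 0)), ?_⟩
  have R1 := rel_ddu α β 0
  have R2 := rel_duu α β 0
  simp only [restrict, d1, LinearMap.coe_mk, AddHom.coe_mk, hg]
  generalize u α β 0 = u at *
  generalize d α β 0 = d at *
  have e1 := congrArg g R1
  have e2 := congrArg g R2
  simp only [zero_smul, add_zero, map_add, map_smul, mul_assoc] at e1 e2
  ext
  · simp only [mul_add, mul_sub, mul_assoc]
    linear_combination (norm := module) e1
  · simp only [mul_add, mul_sub, mul_assoc]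
    linear_combination (norm := module) e2

/-- The comparison `HH²(A) → Ker(d₂*) / Im(d₁*)` between the Hochschild cochain complex and the
complex `A → V* ⊗ A → R* ⊗ A → Ω* ⊗ A`. -/
def comparison : HH2 K (Alg α β 0) →ₗ[K] H2 α β :=
  Submodule.mapQ _ _
    ((restrict α β).restrict fun f hf => restrict_mem_ker α β f hf)
    fun f hf => restrict_mem_range α β f.1 hf

/-- The element `D²U|uᵃ w^{m} d^{a+1} + DU²|u^{a+1} w^{m} dᵃ` of `R* ⊗ A`. -/
def cocycle (r : K) (a m : ℕ) : C2 α β :=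
  (u α β 0 ^ a * w α β 0 r ^ m * d α β 0 ^ (a + 1),
    u α β 0 ^ (a + 1) * w α β 0 r ^ m * d α β 0 ^ a)

end

end DownUp

/-! ### Universal property of the algebra and induction over its generators. -/

namespace DownUp

open Hochschild

section
variable {K : Type*} [Field K]

/-! Write `r`, `s` for the two roots, so that α = r + s and β = -rs. Then w = r(du - s ud), and the
relations become du = s ud + r⁻¹w, dw = r wd, wu = r uw. The monomials uⁱwʲdᵏ are a basis
(`linearIndependent_mono`, `span_mono`), so each bihomogeneous piece is finite-dimensional and
explicit, and every claim becomes a triangular linear system whose diagonal entries are nonzero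
because `r` and `s` satisfy no multiplicative relation.

Kernel: in bidegree (2k, 0) a cocycle is determined by its D²U-part (`eq_of_fst_eq`), and the
D²U-parts of the listed cocycles are all the monomials of that bidegree.

Cohomology: d₁* of D|uⁱw^{k-i}d^{i+1} is a nonzero multiple of the cocycle with index i + 1 plus
terms of lower index (`d1_mono`). Hence every cocycle is cohomologous to a multiple of the one with
index 0 (`cocycle_mem_sup`). That one is not a coboundary (`cocycle_notMem_range`): a preimage may
be taken homogeneous, its U-part can be removed by a commutator since ad u is onto there, and the
same triangularity forces the remaining D-part to vanish.

Passage to `HH²`: the comparison is injective, because a cocycle whose restriction is a coboundary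
defines a split extension of A (`mem_B2_of_restrict_mem_range`). The class is attained by a
homogeneous Hochschild cocycle (`exists_homogeneous_lift`), the factor set of the first-order
deformation in which w ↦ rw is replaced by w ↦ r(w + εw^{k+1}). Surjectivity of the comparison in
general is not needed. -/

theorem exists_algHom (α β : K) {B : Type*} [Ring B] [Algebra K B] (u' d' : B)
    (h1 : d' * d' * u' = α • (d' * u' * d') + β • (u' * d' * d'))
    (h2 : d' * u' * u' = α • (u' * d' * u') + β • (u' * u' * d')) :
    ∃ ρ : Alg α β 0 →ₐ[K] B, ρ (u α β 0) = u' ∧ ρ (d α β 0) = d' := by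
  let φ : FreeAlgebra K Gen →ₐ[K] B := FreeAlgebra.lift K (fun g => Gen.casesOn g u' d')
  have hu : φ (FreeAlgebra.ι K Gen.u) = u' := by simp [φ]
  have hd : φ (FreeAlgebra.ι K Gen.d) = d' := by simp [φ]
  have hφ : ∀ ⦃x y⦄, Rel α β 0 x y → φ x = φ y := by
    intro x y hxy
    cases hxy <;> simp only [map_mul, map_add, map_smul, hu, hd, h1, h2, zero_smul, add_zero]
  let ρ : Alg α β 0 →ₐ[K] B := RingQuot.liftAlgHom K ⟨φ, hφ⟩
  refine ⟨ρ, ?_, ?_⟩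
  · exact (RingQuot.liftAlgHom_mkAlgHom_apply K φ hφ _).trans hu
  · exact (RingQuot.liftAlgHom_mkAlgHom_apply K φ hφ _).trans hd

theorem proj_surjective (α β γ : K) : Function.Surjective (proj α β γ) :=
  RingQuot.mkAlgHom_surjective K _

/-- Induction on left multiplication by the generators. -/
theorem induction_left {α β : K} {P : Alg α β 0 → Prop} (one : P 1)
    (add : ∀ a b, P a → P b → P (a + b)) (smul : ∀ (t : K) a, P a → P (t • a))
    (hu : ∀ a, P a → P (u α β 0 * a)) (hd : ∀ a, P a → P (d α β 0 * a)) (a : Alg α β 0) :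
    P a := by
  obtain ⟨x, rfl⟩ := proj_surjective α β 0 a
  have key : ∀ b, P b → P (proj α β 0 x * b) := by
    induction x using FreeAlgebra.induction with
    | grade0 t =>
      intro b hb
      rw [AlgHom.commutes, ← Algebra.smul_def]
      exact smul t b hb
    | grade1 g =>
      cases g
      · exact hu
      · exact hd
    | mul x y hx hy =>
      intro b hb
      rw [map_mul, mul_assoc]
      exact hx _ (hy _ hb)
    | add x y hx hy =>
      intro b hb
      rw [map_add, add_mul]
      exact add _ _ (hx _ hb) (hy _ hb)
  simpa using key 1 one

/-! ### Commutation relations -/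

/-- The coefficients `r⁻¹ (rⁱ - sⁱ) / (r - s)`. -/
def bracket (r s : K) : ℕ → K
  | 0 => 0
  | i + 1 => s * bracket r s i + r⁻¹ * r ^ i

@[simp] theorem bracket_zero (r s : K) : bracket r s 0 = 0 := rfl

theorem bracket_succ (r s : K) (i : ℕ) :
    bracket r s (i + 1) = s * bracket r s i + r⁻¹ * r ^ i := rfl

/-- `bracket r s i` is r⁻¹ times the sum of all rᵃsᵇ with a + b = i - 1; here the sum is peeled from
its other end. No division by r - s occurs. -/
theorem bracket_succ' (r s : K) (i : ℕ) :
    bracket r s (i + 1) = r * bracket r s i + r⁻¹ * s ^ i := by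
  induction i with
  | zero => simp [bracket_succ]
  | succ i ih =>
    rw [bracket_succ, bracket_succ r s i]
    rw [bracket_succ] at ih
    linear_combination s * ih

theorem bracket_add_two (r s : K) (i : ℕ) :
    bracket r s (i + 2) = (r + s) * bracket r s (i + 1) - r * s * bracket r s i := by
  linear_combination bracket_succ r s (i + 1) - r * bracket_succ r s i

theorem sub_mul_bracket (r s : K) (i : ℕ) :
    (r - s) * bracket r s i = r⁻¹ * (r ^ i - s ^ i) := by
  linear_combination bracket_succ r s i - bracket_succ' r s i

variable (r s : K)

local notation "A" => Alg (r + s) (-(r * s)) (0 : K)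
local notation "𝐮" => u (r + s) (-(r * s)) (0 : K)
local notation "𝐝" => d (r + s) (-(r * s)) (0 : K)
local notation "𝐰" => w (r + s) (-(r * s)) (0 : K) r

theorem d_mul_u (hr : r ≠ 0) : 𝐝 * 𝐮 = s • (𝐮 * 𝐝) + r⁻¹ • 𝐰 := by
  rw [w, smul_add, smul_smul, smul_smul, inv_mul_cancel₀ hr, one_smul, ← add_assoc, ← add_smul]
  have : s + r⁻¹ * -(r * s) = 0 := by field_simp; ring
  rw [this, zero_smul, zero_add]

/-- The relation for d²u factors as d(du - s ud) = r(du - s ud)d, and w is r times the bracketed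
element. -/
theorem d_mul_w : 𝐝 * 𝐰 = r • (𝐰 * 𝐝) := by
  have h := rel_ddu (r + s) (-(r * s)) (0 : K)
  simp only [w, mul_add, add_mul, mul_smul_comm, smul_mul_assoc, ← mul_assoc, h]
  module

theorem w_mul_u : 𝐰 * 𝐮 = r • (𝐮 * 𝐰) := by
  have h := rel_duu (r + s) (-(r * s)) (0 : K)
  simp only [w, mul_add, add_mul, mul_smul_comm, smul_mul_assoc, ← mul_assoc, h]
  module

theorem d_mul_w_pow (j : ℕ) : 𝐝 * 𝐰 ^ j = r ^ j • (𝐰 ^ j * 𝐝) := by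
  induction j with
  | zero => simp
  | succ j ih =>
    rw [pow_succ, ← mul_assoc, ih, smul_mul_assoc, mul_assoc, d_mul_w, mul_smul_comm, smul_smul,
      ← mul_assoc, pow_succ]

theorem w_pow_mul_u (j : ℕ) : 𝐰 ^ j * 𝐮 = r ^ j • (𝐮 * 𝐰 ^ j) := by
  induction j with
  | zero => simp
  | succ j ih =>
    rw [pow_succ', mul_assoc, ih, mul_smul_comm, ← mul_assoc, w_mul_u, smul_mul_assoc, smul_smul,
      mul_assoc, pow_succ]

theorem w_pow_mul_u_pow (j i : ℕ) : 𝐰 ^ j * 𝐮 ^ i = r ^ (j * i) • (𝐮 ^ i * 𝐰 ^ j) := by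
  induction i with
  | zero => simp
  | succ i ih =>
    rw [pow_succ, ← mul_assoc, ih, smul_mul_assoc, mul_assoc, w_pow_mul_u, mul_smul_comm, smul_smul,
      ← mul_assoc, ← pow_add, mul_add_one]

theorem d_pow_mul_w_pow (i j : ℕ) : 𝐝 ^ i * 𝐰 ^ j = r ^ (i * j) • (𝐰 ^ j * 𝐝 ^ i) := by
  induction i with
  | zero => simp
  | succ i ih =>
    rw [pow_succ', mul_assoc, ih, mul_smul_comm, ← mul_assoc, d_mul_w_pow, smul_mul_assoc,
      smul_smul, mul_assoc, ← pow_add, add_one_mul]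

/-- Each passage of d across a u leaves a term r⁻¹w, and these add up to the bracket. The truncated
exponent at i = 0 is harmless, since its coefficient vanishes. -/
theorem d_mul_u_pow (hr : r ≠ 0) (i : ℕ) :
    𝐝 * 𝐮 ^ i = s ^ i • (𝐮 ^ i * 𝐝) + bracket r s i • (𝐮 ^ (i - 1) * 𝐰) := by
  induction i with
  | zero => simp
  | succ i ih =>
    have h1 : 𝐝 * 𝐮 ^ (i + 1) = s • (𝐮 * (𝐝 * 𝐮 ^ i)) + r⁻¹ • (𝐰 * 𝐮 ^ i) := by
      rw [pow_succ', ← mul_assoc, d_mul_u r s hr, add_mul, smul_mul_assoc, smul_mul_assoc,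
        mul_assoc]
    have h2 := w_pow_mul_u_pow r s 1 i
    rw [pow_one, one_mul] at h2
    rw [h1, ih, h2]
    rcases i with _ | i
    · simp [bracket_succ]
    · simp only [mul_add, mul_smul_comm, ← mul_assoc, ← pow_succ', Nat.add_sub_cancel,
        bracket_succ r s (i + 1)]
      module

theorem d_pow_mul_u (hr : r ≠ 0) (i : ℕ) :
    𝐝 ^ i * 𝐮 = s ^ i • (𝐮 * 𝐝 ^ i) + bracket r s i • (𝐰 * 𝐝 ^ (i - 1)) := by
  induction i with
  | zero => simp
  | succ i ih =>
    have h1 : 𝐝 ^ (i + 1) * 𝐮 = s • ((𝐝 ^ i * 𝐮) * 𝐝) + r⁻¹ • (𝐝 ^ i * 𝐰) := by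
      rw [pow_succ, mul_assoc, d_mul_u r s hr, mul_add, mul_smul_comm, mul_smul_comm,
        mul_assoc]
    have h2 := d_pow_mul_w_pow r s i 1
    rw [pow_one, mul_one] at h2
    rw [h1, ih, h2]
    rcases i with _ | i
    · simp [bracket_succ]
    · simp only [add_mul, smul_mul_assoc, mul_assoc, ← pow_succ, Nat.add_sub_cancel,
        bracket_succ r s (i + 1)]
      module

/-- The monomials `uⁱ wʲ dᵏ`. -/
def mono (t : ℕ × ℕ × ℕ) : A := 𝐮 ^ t.1 * 𝐰 ^ t.2.1 * 𝐝 ^ t.2.2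

local notation "e" => mono r s

theorem u_mul_mono (i j k : ℕ) : 𝐮 * e (i, j, k) = e (i + 1, j, k) := by
  simp only [mono, ← mul_assoc, pow_succ']

theorem mono_mul_d (i j k : ℕ) : e (i, j, k) * 𝐝 = e (i, j, k + 1) := by
  simp only [mono, mul_assoc, pow_succ]

theorem w_pow_mul_mono (n i j k : ℕ) :
    𝐰 ^ n * e (i, j, k) = r ^ (n * i) • e (i, j + n, k) := by
  simp only [mono, ← mul_assoc]
  rw [w_pow_mul_u_pow, smul_mul_assoc, smul_mul_assoc, mul_assoc (𝐮 ^ i), ← pow_add, add_comm n]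

theorem d_mul_mono (hr : r ≠ 0) (i j k : ℕ) :
    𝐝 * e (i, j, k)
      = (s ^ i * r ^ j) • e (i, j, k + 1) + bracket r s i • e (i - 1, j + 1, k) := by
  simp only [mono, ← mul_assoc]
  rw [d_mul_u_pow r s hr, add_mul, add_mul, smul_mul_assoc, mul_assoc (𝐮 ^ i), d_mul_w_pow]
  simp only [smul_mul_assoc, mul_smul_comm, smul_smul, mul_assoc, ← pow_succ']

theorem mono_mul_u (hr : r ≠ 0) (i j k : ℕ) :
    e (i, j, k) * 𝐮
      = (s ^ k * r ^ j) • e (i + 1, j, k) + bracket r s k • e (i, j + 1, k - 1) := by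
  simp only [mono, mul_assoc]
  rw [d_pow_mul_u r s hr, mul_add, mul_add, mul_smul_comm, ← mul_assoc (𝐰 ^ j) 𝐮, w_pow_mul_u]
  simp only [smul_mul_assoc, mul_smul_comm, smul_smul, ← mul_assoc, ← pow_succ]

/-! ### The monomial basis -/

open Finsupp in
/-- The action of `u` on the space with basis `ℕ³`. -/
noncomputable def uOp : (ℕ × ℕ × ℕ →₀ K) →ₗ[K] (ℕ × ℕ × ℕ →₀ K) :=
  linearCombination K fun t => single (t.1 + 1, t.2) 1

open Finsupp in
/-- The action of `d` on the space with basis `ℕ³`. -/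
noncomputable def dOp : (ℕ × ℕ × ℕ →₀ K) →ₗ[K] (ℕ × ℕ × ℕ →₀ K) :=
  linearCombination K fun t => (s ^ t.1 * r ^ t.2.1) • single (t.1, t.2.1, t.2.2 + 1) 1
    + bracket r s t.1 • single (t.1 - 1, t.2.1 + 1, t.2.2) 1

open Finsupp in
theorem uOp_single (i j k : ℕ) :
    uOp (K := K) (single (i, j, k) 1) = single (i + 1, j, k) 1 := by
  simp [uOp]

open Finsupp in
theorem dOp_single (i j k : ℕ) :
    dOp r s (single (i, j, k) 1) = (s ^ i * r ^ j) • single (i, j, k + 1) 1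
    + bracket r s i • single (i - 1, j + 1, k) 1 := by
  rw [dOp, linearCombination_single, one_smul]

open Finsupp in
theorem dOp_rel_ddu : dOp r s * dOp r s * uOp
    = (r + s) • (dOp r s * uOp * dOp r s) + (-(r * s)) • (uOp * dOp r s * dOp r s) := by
  refine Finsupp.lhom_ext' fun ⟨i, j, k⟩ => LinearMap.ext_ring ?_
  rcases i with _ | i
  · simp only [LinearMap.comp_apply, lsingle_apply, Module.End.mul_apply, LinearMap.add_apply,
      LinearMap.smul_apply, uOp_single, dOp_single, map_add, map_smul, bracket_succ, bracket_zero,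
      Nat.add_sub_cancel]
    module
  · simp only [LinearMap.comp_apply, lsingle_apply, Module.End.mul_apply, LinearMap.add_apply,
      LinearMap.smul_apply, uOp_single, dOp_single, map_add, map_smul,
      Nat.add_sub_cancel]
    rcases i with _ | i
    · simp only [bracket_succ, bracket_zero]
      module
    · simp only [bracket_succ, Nat.add_sub_cancel]
      match_scalars <;> ring

open Finsupp in
theorem dOp_rel_duu : dOp r s * uOp * uOp
    = (r + s) • (uOp * dOp r s * uOp) + (-(r * s)) • (uOp * uOp * dOp r s) := by
  refine Finsupp.lhom_ext' fun ⟨i, j, k⟩ => LinearMap.ext_ring ?_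
  rcases i with _ | i <;>
  · simp only [LinearMap.comp_apply, lsingle_apply, Module.End.mul_apply, LinearMap.add_apply,
      LinearMap.smul_apply, uOp_single, dOp_single, map_add, map_smul, bracket_succ, bracket_zero,
      Nat.add_sub_cancel]
    module

open Finsupp in
-- The operators `uOp` and `dOp` copy the expected left multiplications on a space with basis ℕ³.
-- Applied to the vector (0, 0, 0), the monomials give the distinct basis vectors.
theorem linearIndependent_mono (hr : r ≠ 0) : LinearIndependent K e := by
  obtain ⟨ρ, hu, hd⟩ := exists_algHom (r + s) (-(r * s)) uOp (dOp r s)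
    (dOp_rel_ddu r s) (dOp_rel_duu r s)
  -- First index 0 suffices: in uⁱwʲdᵏ the factor wʲ acts before any u.
  have hw : ∀ j k, ρ 𝐰 (single (0, j, k) 1) = single (0, j + 1, k) 1 := by
    intro j k
    rw [w, map_add, map_smul, map_smul, map_mul, map_mul, hu, hd]
    simp only [LinearMap.add_apply, LinearMap.smul_apply, Module.End.mul_apply, uOp_single,
      dOp_single, bracket_succ, bracket_zero, map_add, map_smul]
    match_scalars <;> field_simp <;> ring
  let ev : A →ₗ[K] (ℕ × ℕ × ℕ →₀ K) :=
    (LinearMap.applyₗ (single (0, 0, 0) 1)).comp ρ.toLinearMap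
  have hev : ev ∘ e = fun t => single t 1 := by
    funext ⟨i, j, k⟩
    change ρ (𝐮 ^ i * 𝐰 ^ j * 𝐝 ^ k) (single (0, 0, 0) 1) = _
    have h1 : (ρ 𝐝 ^ k) (single (0, 0, 0) 1) = single (0, 0, k) 1 := by
      induction k with
      | zero => rfl
      | succ k ih => rw [pow_succ', Module.End.mul_apply, ih, hd, dOp_single]; simp
    have h2 : (ρ 𝐰 ^ j) (single (0, 0, k) 1) = single (0, j, k) 1 := by
      induction j with
      | zero => rfl
      | succ j ih => rw [pow_succ', Module.End.mul_apply, ih, hw]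
    have h3 : (ρ 𝐮 ^ i) (single (0, j, k) 1) = single (i, j, k) 1 := by
      induction i with
      | zero => rfl
      | succ i ih => rw [pow_succ', Module.End.mul_apply, ih, hu, uOp_single]
    rw [map_mul, map_mul, map_pow, map_pow, map_pow, Module.End.mul_apply, Module.End.mul_apply,
      h1, h2, h3]
  refine LinearIndependent.of_comp ev ?_
  rw [hev]
  exact (Finsupp.basisSingleOne (R := K)).linearIndependent

/-- The span contains 1 and is stable under left multiplication by u and d. -/
theorem span_mono (hr : r ≠ 0) : ⊤ ≤ Submodule.span K (Set.range e) := by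
  rintro a -
  induction a using induction_left with
  | one => exact Submodule.subset_span ⟨(0, 0, 0), by simp [mono]⟩
  | add a b ha hb => exact Submodule.add_mem _ ha hb
  | smul t a ha => exact Submodule.smul_mem _ t ha
  | hu a ha =>
    induction ha using Submodule.span_induction with
    | mem x hx =>
      obtain ⟨⟨i, j, k⟩, rfl⟩ := hx
      rw [u_mul_mono]
      exact Submodule.subset_span ⟨_, rfl⟩
    | zero => simp
    | add x y _ _ hx hy => rw [mul_add]; exact Submodule.add_mem _ hx hy
    | smul t x _ hx => rw [mul_smul_comm]; exact Submodule.smul_mem _ t hx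
  | hd a ha =>
    induction ha using Submodule.span_induction with
    | mem x hx =>
      obtain ⟨⟨i, j, k⟩, rfl⟩ := hx
      rw [d_mul_mono r s hr]
      exact Submodule.add_mem _ (Submodule.smul_mem _ _ (Submodule.subset_span ⟨_, rfl⟩))
        (Submodule.smul_mem _ _ (Submodule.subset_span ⟨_, rfl⟩))
    | zero => simp
    | add x y _ _ hx hy => rw [mul_add]; exact Submodule.add_mem _ hx hy
    | smul t x _ hx => rw [mul_smul_comm]; exact Submodule.smul_mem _ t hx

/-- The basis of `A` consisting of the monomials `uⁱ wʲ dᵏ`. -/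
noncomputable def monoBasis (hr : r ≠ 0) : Module.Basis (ℕ × ℕ × ℕ) K A :=
  .mk (linearIndependent_mono r s hr) (span_mono r s hr)

@[simp] theorem monoBasis_apply (hr : r ≠ 0) (t : ℕ × ℕ × ℕ) : monoBasis r s hr t = e t := by
  simp [monoBasis]

end

end DownUp

namespace DownUp

open Hochschild

section
variable {K : Type*} [Field K]

/-! ### The bigrading -/

section
variable {α β : K}

theorem mul_mem_component {n s n' s' : ℤ} {a b : Alg α β 0} (ha : a ∈ component α β n s)
    (hb : b ∈ component α β n' s') : a * b ∈ component α β (n + n') (s + s') := by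
  induction ha using Submodule.span_induction with
  | mem x hx =>
    obtain ⟨l, h1, h2, rfl⟩ := hx
    induction hb using Submodule.span_induction with
    | mem y hy =>
      obtain ⟨l', h1', h2', rfl⟩ := hy
      refine Submodule.subset_span ⟨l ++ l', ?_, ?_, by simp⟩
      · push_cast [List.length_append]; omega
      · push_cast [List.count_append]; omega
    | zero => simp
    | add x y _ _ hx hy => rw [mul_add]; exact Submodule.add_mem _ hx hy
    | smul t x _ hx => rw [mul_smul_comm]; exact Submodule.smul_mem _ t hx
  | zero => simp
  | add x y _ _ hx hy => rw [add_mul]; exact Submodule.add_mem _ hx hy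
  | smul t x _ hx => rw [smul_mul_assoc]; exact Submodule.smul_mem _ t hx

theorem component_cast {n s n' s' : ℤ} {a : Alg α β 0} (ha : a ∈ component α β n s)
    (hn : n = n') (hs : s = s') : a ∈ component α β n' s' := hn ▸ hs ▸ ha

theorem mul_mul_mem_component {n₁ s₁ n₂ s₂ n₃ s₃ n s : ℤ} {a b c : Alg α β 0}
    (ha : a ∈ component α β n₁ s₁) (hb : b ∈ component α β n₂ s₂) (hc : c ∈ component α β n₃ s₃)
    (hn : n₁ + n₂ + n₃ = n) (hs : s₁ + s₂ + s₃ = s) : a * b * c ∈ component α β n s :=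
  component_cast (mul_mem_component (mul_mem_component ha hb) hc) hn hs

theorem one_mem_component : (1 : Alg α β 0) ∈ component α β 0 0 :=
  Submodule.subset_span ⟨[], by simp⟩

theorem u_mem_component : u α β 0 ∈ component α β 1 1 :=
  Submodule.subset_span ⟨[Gen.u], by simp [u]⟩

theorem d_mem_component : d α β 0 ∈ component α β 1 (-1) :=
  Submodule.subset_span ⟨[Gen.d], by simp [d]⟩

theorem w_mem_component (r : K) : w α β 0 r ∈ component α β 2 0 :=
  Submodule.add_mem _
    (Submodule.smul_mem _ _ (component_cast (mul_mem_component u_mem_component d_mem_component)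
      (by norm_num) (by norm_num)))
    (Submodule.smul_mem _ _ (component_cast (mul_mem_component d_mem_component u_mem_component)
      (by norm_num) (by norm_num)))

theorem pow_mem_component {n s : ℤ} {a : Alg α β 0} (ha : a ∈ component α β n s) (i : ℕ) :
    a ^ i ∈ component α β (i * n) (i * s) := by
  induction i with
  | zero => simpa using one_mem_component
  | succ i ih =>
    rw [pow_succ]
    exact component_cast (mul_mem_component ih ha) (by push_cast; ring) (by push_cast; ring)

end

variable (r s : K)

local notation "A" => Alg (r + s) (-(r * s)) (0 : K)
local notation "𝐮" => u (r + s) (-(r * s)) (0 : K)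
local notation "𝐝" => d (r + s) (-(r * s)) (0 : K)
local notation "𝐰" => w (r + s) (-(r * s)) (0 : K) r
local notation "e" => mono r s
local notation "comp" => component (r + s) (-(r * s))

/-- The degree of `uⁱ wʲ dᵏ`. -/
def deg (t : ℕ × ℕ × ℕ) : ℤ := t.1 + 2 * t.2.1 + t.2.2

/-- The special degree of `uⁱ wʲ dᵏ`. -/
def sdeg (t : ℕ × ℕ × ℕ) : ℤ := t.1 - t.2.2

theorem mono_mem_component (t : ℕ × ℕ × ℕ) : e t ∈ comp (deg t) (sdeg t) :=
  component_cast (mul_mem_component (mul_mem_component (pow_mem_component u_mem_component _)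
    (pow_mem_component (w_mem_component r) _)) (pow_mem_component d_mem_component _))
    (by simp only [deg]; ring) (by simp only [sdeg]; ring)

theorem component_eq_span (hr : r ≠ 0) (n p : ℤ) :
    comp n p = Submodule.span K (e '' {t | deg t = n ∧ sdeg t = p}) := by
  apply le_antisymm
  · refine Submodule.span_le.2 ?_
    rintro x ⟨l, h1, h2, rfl⟩
    induction l generalizing n p with
    | nil =>
      refine Submodule.subset_span ⟨(0, 0, 0), ?_, by simp [mono]⟩
      simp at h1 h2
      simp [deg, sdeg, ← h1, ← h2]
    | cons g l ih =>
      rw [List.map_cons, List.prod_cons]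
      cases g with
      | u =>
        have := ih (n - 1) (p - 1) (by simp at h1; omega) (by simp at h2; omega)
        change 𝐮 * _ ∈ _
        revert this
        generalize (l.map (gen (r + s) (-(r * s)) 0)).prod = x
        intro hx
        induction hx using Submodule.span_induction with
        | mem x hx =>
          obtain ⟨⟨i, j, k⟩, ⟨ht1, ht2⟩, rfl⟩ := hx
          rw [u_mul_mono]
          refine Submodule.subset_span ⟨_, ⟨?_, ?_⟩, rfl⟩ <;> simp [deg, sdeg] at * <;> omega
        | zero => simp
        | add x y _ _ hx hy => rw [mul_add]; exact Submodule.add_mem _ hx hy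
        | smul t x _ hx => rw [mul_smul_comm]; exact Submodule.smul_mem _ t hx
      | d =>
        have := ih (n - 1) (p + 1) (by simp at h1; omega) (by simp at h2; omega)
        change 𝐝 * _ ∈ _
        revert this
        generalize (l.map (gen (r + s) (-(r * s)) 0)).prod = x
        intro hx
        induction hx using Submodule.span_induction with
        | mem x hx =>
          obtain ⟨⟨i, j, k⟩, ⟨ht1, ht2⟩, rfl⟩ := hx
          rw [d_mul_mono r s hr]
          refine Submodule.add_mem _ (Submodule.smul_mem _ _ (Submodule.subset_span
            ⟨_, ⟨?_, ?_⟩, rfl⟩)) ?_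
          · simp [deg] at *; omega
          · simp [sdeg] at *; omega
          -- For i = 0 the truncated monomial has the wrong bidegree, but its coefficient is
          -- `bracket r s 0 = 0`.
          · rcases i with _ | i
            · simp
            · refine Submodule.smul_mem _ _ (Submodule.subset_span ⟨_, ⟨?_, ?_⟩, rfl⟩) <;>
                simp [deg, sdeg] at * <;> omega
        | zero => simp
        | add x y _ _ hx hy => rw [mul_add]; exact Submodule.add_mem _ hx hy
        | smul t x _ hx => rw [mul_smul_comm]; exact Submodule.smul_mem _ t hx
  · refine Submodule.span_le.2 ?_
    rintro _ ⟨t, ⟨rfl, rfl⟩, rfl⟩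
    exact mono_mem_component r s t

/-- The projection of `A` onto its component of bidegree `(n, p)`. -/
noncomputable def piece (hr : r ≠ 0) (n p : ℤ) : A →ₗ[K] A :=
  (monoBasis r s hr).constr K fun t => if deg t = n ∧ sdeg t = p then e t else 0

theorem piece_mono (hr : r ≠ 0) (n p : ℤ) (t : ℕ × ℕ × ℕ) :
    piece r s hr n p (e t) = if deg t = n ∧ sdeg t = p then e t else 0 := by
  have h := (monoBasis r s hr).constr_basis K
    (fun t => if deg t = n ∧ sdeg t = p then e t else 0) t
  rwa [monoBasis_apply] at h

variable {r s}

theorem piece_of_mem (hr : r ≠ 0) {n p : ℤ} {a : A} (ha : a ∈ comp n p) :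
    piece r s hr n p a = a := by
  rw [component_eq_span r s hr] at ha
  induction ha using Submodule.span_induction with
  | mem x hx =>
    obtain ⟨t, ht, rfl⟩ := hx
    rw [piece_mono]
    exact if_pos ht
  | zero => simp
  | add x y _ _ hx hy => rw [map_add, hx, hy]
  | smul t x _ hx => rw [map_smul, hx]

theorem piece_of_mem_of_ne (hr : r ≠ 0) {n p n' p' : ℤ} {a : A} (ha : a ∈ comp n p)
    (h : ¬ (n = n' ∧ p = p')) : piece r s hr n' p' a = 0 := by
  rw [component_eq_span r s hr] at ha
  induction ha using Submodule.span_induction with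
  | mem x hx =>
    obtain ⟨t, ht, rfl⟩ := hx
    rw [piece_mono, if_neg]
    rintro ⟨h1, h2⟩
    exact h ⟨ht.1.symm.trans h1, ht.2.symm.trans h2⟩
  | zero => simp
  | add x y _ _ hx hy => rw [map_add, hx, hy, add_zero]
  | smul t x _ hx => rw [map_smul, hx, smul_zero]

theorem piece_mem (hr : r ≠ 0) (n p : ℤ) (a : A) : piece r s hr n p a ∈ comp n p := by
  have ha : a ∈ Submodule.span K (Set.range e) := span_mono r s hr trivial
  induction ha using Submodule.span_induction with
  | zero => simp
  | add x y _ _ hx hy => rw [map_add]; exact Submodule.add_mem _ hx hy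
  | smul t x _ hx => rw [map_smul]; exact Submodule.smul_mem _ t hx
  | mem x hx =>
    obtain ⟨t, rfl⟩ := hx
    rw [piece_mono]
    split_ifs with h
    · obtain ⟨rfl, rfl⟩ := h
      exact mono_mem_component r s t
    · exact Submodule.zero_mem _

theorem piece_comm (hr : r ≠ 0) {n p : ℤ} (T : A →ₗ[K] A)
    (hT : ∀ n' p', ∀ a ∈ comp n' p', T a ∈ comp (n' + n) (p' + p)) (n' p' : ℤ) (a : A) :
    piece r s hr (n' + n) (p' + p) (T a) = T (piece r s hr n' p' a) := by
  have : (piece r s hr (n' + n) (p' + p)).comp T = T.comp (piece r s hr n' p') := by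
    refine (monoBasis r s hr).ext fun t => ?_
    simp only [LinearMap.comp_apply, monoBasis_apply]
    have h := hT _ _ _ (mono_mem_component r s t)
    rw [piece_mono]
    split_ifs with h'
    · obtain ⟨rfl, rfl⟩ := h'
      exact piece_of_mem hr h
    · rw [map_zero]
      refine piece_of_mem_of_ne hr h fun h'' => h' ⟨?_, ?_⟩ <;> omega
  exact LinearMap.congr_fun this a

end

end DownUp

namespace DownUp

open Hochschild

section
variable {K : Type*} [Field K]

/-! ### The complex `A → V* ⊗ A → R* ⊗ A → Ω* ⊗ A` -/

section
variable {α β : K}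

theorem d1_fst (a a' : Alg α β 0) : (d1 α β (a, a')).1
    = d α β 0 * d α β 0 * a + a' * d α β 0 * u α β 0 + d α β 0 * a' * u α β 0
      - α • (d α β 0 * a * d α β 0 + a' * u α β 0 * d α β 0 + d α β 0 * u α β 0 * a')
      - β • (a * d α β 0 * d α β 0 + u α β 0 * a' * d α β 0 + u α β 0 * d α β 0 * a') := rfl

theorem d1_snd (a a' : Alg α β 0) : (d1 α β (a, a')).2
    = d α β 0 * a * u α β 0 + d α β 0 * u α β 0 * a + a' * u α β 0 * u α β 0
      - α • (a * d α β 0 * u α β 0 + u α β 0 * d α β 0 * a + u α β 0 * a' * u α β 0)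
      - β • (a * u α β 0 * d α β 0 + u α β 0 * a * d α β 0 + u α β 0 * u α β 0 * a') := rfl

theorem d2_apply (a a' : Alg α β 0) : d2 α β (a, a')
    = d α β 0 * a' + β • (a' * d α β 0) - a * u α β 0 - β • (u α β 0 * a) := rfl

/-- This is d₁* ∘ d₀* = 0: after expansion only the commutator of z with a defining relation is
left. -/
theorem d1_commutator (z : Alg α β 0) :
    d1 α β (u α β 0 * z - z * u α β 0, d α β 0 * z - z * d α β 0) = 0 := by
  have R1 := rel_ddu α β 0
  have R2 := rel_duu α β 0
  ext
  · rw [d1_fst, Prod.fst_zero]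
    generalize u α β 0 = u at *
    generalize d α β 0 = d at *
    have e1 := congrArg (z * ·) R1
    have e2 := congrArg (· * z) R1
    simp only [zero_smul, add_zero, mul_add, mul_sub, add_mul, sub_mul, mul_assoc, mul_smul_comm,
      smul_mul_assoc] at *
    linear_combination (norm := module) e2 - e1
  · rw [d1_snd, Prod.snd_zero]
    generalize u α β 0 = u at *
    generalize d α β 0 = d at *
    have e1 := congrArg (z * ·) R2
    have e2 := congrArg (· * z) R2
    simp only [zero_smul, add_zero, mul_add, mul_sub, add_mul, sub_mul, mul_assoc, mul_smul_comm,
      smul_mul_assoc] at *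
    linear_combination (norm := module) e2 - e1

theorem d1_mem_ker (x : C1 α β) : d1 α β x ∈ Z α β := by
  obtain ⟨a, a'⟩ := x
  have R1 := rel_ddu α β 0
  have R2 := rel_duu α β 0
  rw [LinearMap.mem_ker, ← Prod.mk.eta (p := d1 α β (a, a')), d2_apply, d1_fst, d1_snd]
  generalize u α β 0 = u at *
  generalize d α β 0 = d at *
  have e1 := congrArg (· * a) R1
  have e2 := congrArg (· * a') R2
  have e3 := congrArg (a * ·) R1
  have e4 := congrArg (a' * ·) R2
  simp only [zero_smul, add_zero, mul_add, mul_sub, add_mul, sub_mul, mul_assoc, mul_smul_comm,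
    smul_mul_assoc] at *
  linear_combination (norm := module) e1 - β • e2 + β • e3 - e4

theorem d1_mem_C2component {n p : ℤ} {a a' : Alg α β 0} (ha : a ∈ component α β (n + 1) (p + 1))
    (ha' : a' ∈ component α β (n + 1) (p - 1)) : d1 α β (a, a') ∈ C2component α β n p := by
  have hu := u_mem_component (α := α) (β := β)
  have hd := d_mem_component (α := α) (β := β)
  constructor
  · rw [d1_fst]
    refine Submodule.sub_mem _ (Submodule.sub_mem _ (add_mem (add_mem ?_ ?_) ?_)
      (Submodule.smul_mem _ _ (add_mem (add_mem ?_ ?_) ?_)))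
      (Submodule.smul_mem _ _ (add_mem (add_mem ?_ ?_) ?_)) <;>
    apply mul_mul_mem_component
    all_goals first
      | assumption
      | ring
  · rw [d1_snd]
    refine Submodule.sub_mem _ (Submodule.sub_mem _ (add_mem (add_mem ?_ ?_) ?_)
      (Submodule.smul_mem _ _ (add_mem (add_mem ?_ ?_) ?_)))
      (Submodule.smul_mem _ _ (add_mem (add_mem ?_ ?_) ?_)) <;>
    apply mul_mul_mem_component
    all_goals first
      | assumption
      | ring

end

variable {r s : K}

local notation "A" => Alg (r + s) (-(r * s)) (0 : K)
local notation "𝐮" => u (r + s) (-(r * s)) (0 : K)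
local notation "𝐝" => d (r + s) (-(r * s)) (0 : K)
local notation "𝐰" => w (r + s) (-(r * s)) (0 : K) r
local notation "e" => mono r s
local notation "comp" => component (r + s) (-(r * s))
local notation "δ" => d1 (r + s) (-(r * s))
local notation "cc" => cocycle (r + s) (-(r * s)) r

/-- Each of the four blocks A → A of d₁* shifts the bidegree by a constant, so it commutes with the
projections `piece`. Projecting an arbitrary preimage therefore gives a homogeneous one. -/
theorem exists_homogeneous_preimage (hr : r ≠ 0) {n p : ℤ} {x : C2 (r + s) (-(r * s))}
    (hx : x ∈ C2component (r + s) (-(r * s)) n p) (h : x ∈ LinearMap.range δ) :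
    ∃ a ∈ comp (n + 1) (p + 1), ∃ a' ∈ comp (n + 1) (p - 1), δ (a, a') = x := by
  obtain ⟨⟨a, a'⟩, rfl⟩ := h
  refine ⟨_, piece_mem hr (n + 1) (p + 1) a, _, piece_mem hr (n + 1) (p - 1) a', ?_⟩
  have split : ∀ b b', δ (b, b') = δ (b, 0) + δ (0, b') := by
    intro b b'
    rw [← map_add, Prod.mk_add_mk, add_zero, zero_add]
  have h11 := piece_comm hr (n := 2) (p := -2)
    (LinearMap.fst K A A ∘ₗ δ ∘ₗ LinearMap.inl K A A) (fun n' p' b hb => component_cast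
      (d1_mem_C2component (n := n' - 1) (p := p' - 1) (component_cast hb (by ring) (by ring))
        (Submodule.zero_mem _)).1 (by ring) (by ring)) (n + 1) (p + 1) a
  have h21 := piece_comm hr (n := 2) (p := 0)
    (LinearMap.snd K A A ∘ₗ δ ∘ₗ LinearMap.inl K A A) (fun n' p' b hb => component_cast
      (d1_mem_C2component (n := n' - 1) (p := p' - 1) (component_cast hb (by ring) (by ring))
        (Submodule.zero_mem _)).2 (by ring) (by ring)) (n + 1) (p + 1) a
  have h12 := piece_comm hr (n := 2) (p := 0)
    (LinearMap.fst K A A ∘ₗ δ ∘ₗ LinearMap.inr K A A) (fun n' p' b hb => component_cast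
      (d1_mem_C2component (n := n' - 1) (p := p' + 1) (Submodule.zero_mem _)
        (component_cast hb (by ring) (by ring))).1 (by ring) (by ring)) (n + 1) (p - 1) a'
  have h22 := piece_comm hr (n := 2) (p := 2)
    (LinearMap.snd K A A ∘ₗ δ ∘ₗ LinearMap.inr K A A) (fun n' p' b hb => component_cast
      (d1_mem_C2component (n := n' - 1) (p := p' + 1) (Submodule.zero_mem _)
        (component_cast hb (by ring) (by ring))).2 (by ring) (by ring)) (n + 1) (p - 1) a'
  rw [show n + 1 + 2 = n + 3 by ring] at h11 h12 h21 h22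
  rw [show p + 1 + -2 = p - 1 by ring] at h11
  rw [show p + 1 + 0 = p + 1 by ring] at h21
  rw [show p - 1 + 0 = p - 1 by ring] at h12
  rw [show p - 1 + 2 = p + 1 by ring] at h22
  simp only [LinearMap.comp_apply, LinearMap.inl_apply, LinearMap.inr_apply, LinearMap.fst_apply,
    LinearMap.snd_apply] at h11 h12 h21 h22
  rw [split]
  ext
  · rw [Prod.fst_add, ← h11, ← h12, ← map_add, ← Prod.fst_add, ← split]
    exact piece_of_mem hr hx.1
  · rw [Prod.snd_add, ← h21, ← h22, ← map_add, ← Prod.snd_add, ← split]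
    exact piece_of_mem hr hx.2

/-! ### The kernel of d₂* in bidegree (2k, 0). -/

theorem exists_eq_sum_of_mem (hr : r ≠ 0) {n p : ℤ} (N : ℕ) (f : ℕ → ℕ × ℕ × ℕ)
    (hf : ∀ t, deg t = n → sdeg t = p → ∃ i < N, t = f i) {a : A} (ha : a ∈ comp n p) :
    ∃ q : ℕ → K, a = ∑ i ∈ Finset.range N, q i • e (f i) := by
  rw [component_eq_span r s hr] at ha
  induction ha using Submodule.span_induction with
  | mem x hx =>
    obtain ⟨t, ⟨h1, h2⟩, rfl⟩ := hx
    obtain ⟨i, hi, rfl⟩ := hf t h1 h2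
    refine ⟨Pi.single i 1, ?_⟩
    rw [Finset.sum_eq_single i]
    · simp
    · intro j _ hj
      simp [hj]
    · simp [hi]
  | zero => exact ⟨0, by simp⟩
  | add x y _ _ hx hy =>
    obtain ⟨q, rfl⟩ := hx
    obtain ⟨q', rfl⟩ := hy
    exact ⟨q + q', by simp [add_smul, Finset.sum_add_distrib]⟩
  | smul t x _ hx =>
    obtain ⟨q, rfl⟩ := hx
    exact ⟨t • q, by simp [Finset.smul_sum, smul_smul]⟩

theorem coord_mono (hr : r ≠ 0) (t t' : ℕ × ℕ × ℕ) :
    (monoBasis r s hr).coord t (e t') = if t' = t then 1 else 0 := by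
  rw [← monoBasis_apply r s hr, Module.Basis.coord_apply, Module.Basis.repr_self,
    Finsupp.single_apply]

/-- Moving d from the left of the DU²-part and u from the right of the D²U-part produces the same
two coefficients, so everything cancels. -/
theorem cocycle_mem_ker (hr : r ≠ 0) (a m : ℕ) : cc a m ∈ Z (r + s) (-(r * s)) := by
  change d2 _ _ (e (a, m, a + 1), e (a + 1, m, a)) = 0
  rw [d2_apply, d_mul_mono r s hr, mono_mul_d, mono_mul_u r s hr, u_mul_mono]
  simp only [Nat.add_sub_cancel]
  module

theorem cocycle_mem_C2component {a k : ℕ} (ha : a ≤ k + 1) :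
    cc a (k + 1 - a) ∈ C2component (r + s) (-(r * s)) (2 * k) 0 :=
  ⟨component_cast (mono_mem_component r s (a, k + 1 - a, a + 1))
      (by simp only [deg]; omega) (by simp only [sdeg]; omega),
    component_cast (mono_mem_component r s (a + 1, k + 1 - a, a))
      (by simp only [deg]; omega) (by simp only [sdeg]; omega)⟩

/-- A zero would force r^{i+1} = s^{i+1}, a forbidden multiplicative relation. -/
theorem bracket_ne_zero (hr : r ≠ 0) (hgen : ∀ i j : ℤ, (i, j) ≠ (0, 0) → r ^ i * s ^ j ≠ 1)
    (hs : s ≠ 0) (i : ℕ) : bracket r s (i + 1) ≠ 0 := by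
  intro h
  have h1 := sub_mul_bracket r s (i + 1)
  rw [h, mul_zero, eq_comm, mul_eq_zero, sub_eq_zero] at h1
  rcases h1 with h1 | h1
  · exact inv_ne_zero hr h1
  · refine hgen (i + 1) (-(i + 1)) (by simp; omega) ?_
    rw [zpow_neg]
    have h2 : r ^ (i + 1 : ℤ) = s ^ (i + 1 : ℤ) := by exact_mod_cast h1
    rw [h2]
    exact mul_inv_cancel₀ (zpow_ne_zero _ hs)

section generic

variable (hr : r ≠ 0) (hs : s ≠ 0) (hgen : ∀ i j : ℤ, (i, j) ≠ (0, 0) → r ^ i * s ^ j ≠ 1)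
include hr hs hgen

/-- The system for the coefficients q i is triangular with diagonal entries `bracket r s (i + 1)`.
-/
theorem eq_zero_of_d2_eq_zero {k : ℕ} {y : A} (hy : y ∈ comp (2 * k + 3) (0 + 1))
    (h : d2 (r + s) (-(r * s)) (0, y) = 0) : y = 0 := by
  obtain ⟨q, rfl⟩ := exists_eq_sum_of_mem hr (k + 2) (fun i => (i + 1, k + 1 - i, i)) (by
    rintro ⟨i, j, l⟩ h1 h2
    simp only [deg, sdeg] at h1 h2
    refine ⟨l, by omega, ?_⟩
    simp only [Prod.mk.injEq, and_true]
    omega) hy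
  rw [d2_apply, zero_mul, mul_zero, sub_zero, smul_zero, sub_zero, Finset.mul_sum,
    Finset.sum_mul, Finset.smul_sum, ← Finset.sum_add_distrib] at h
  suffices ∀ i < k + 2, q i = 0 by
    refine Finset.sum_eq_zero fun i hi => ?_
    rw [this i (Finset.mem_range.1 hi), zero_smul]
  intro i hi
  induction i using Nat.strong_induction_on with
  | _ i ih =>
    -- The monomial uⁱw^{k+2-i}dⁱ arises only from the indices i, with coefficient the bracket, and
    -- i - 1, whose coefficient is already known to be zero.
    have h' := congrArg ((monoBasis r s hr).coord (i, k + 2 - i, i)) h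
    rw [map_sum, map_zero, Finset.sum_eq_single i] at h'
    · simp only [mul_smul_comm, smul_mul_assoc, d_mul_mono r s hr, mono_mul_d, map_add, map_smul,
        coord_mono, Nat.add_sub_cancel, Prod.mk.injEq, and_true, true_and] at h'
      split_ifs at h' <;> try omega
      simpa [bracket_ne_zero hr hgen hs i] using h'
    · intro j hj hij
      rcases lt_or_gt_of_ne hij with hlt | hlt
      · rw [ih j hlt (by omega)]
        simp
      · simp only [mul_smul_comm, smul_mul_assoc, d_mul_mono r s hr, mono_mul_d, map_add, map_smul,
          coord_mono, Nat.add_sub_cancel, Prod.mk.injEq]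
        split_ifs <;> first | omega | simp
    · simp [hi]

/-- Lets identities between cocycles of this bidegree be checked on D²U-parts alone. -/
theorem eq_of_fst_eq {k : ℕ} {x y : C2 (r + s) (-(r * s))}
    (hx : x ∈ Zcomponent (r + s) (-(r * s)) (2 * k) 0)
    (hy : y ∈ Zcomponent (r + s) (-(r * s)) (2 * k) 0) (h : x.1 = y.1) : x = y := by
  have hxy := Submodule.sub_mem _ hx hy
  have h1 : (x - y).1 = 0 := by rw [Prod.fst_sub, h, sub_self]
  refine sub_eq_zero.1 (Prod.ext h1 ?_)
  refine eq_zero_of_d2_eq_zero hr hs hgen hxy.2.2 ?_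
  have : x - y ∈ LinearMap.ker _ := hxy.1
  rw [LinearMap.mem_ker, ← Prod.mk.eta (p := x - y), h1] at this
  exact this

theorem Zcomponent_eq_span (k : ℕ) : Zcomponent (r + s) (-(r * s)) (2 * k) 0
    = Submodule.span K {x | ∃ a : ℕ, a ≤ k + 1 ∧ x = cc a (k + 1 - a)} := by
  have hmem : ∀ a ≤ k + 1, cc a (k + 1 - a) ∈ Zcomponent (r + s) (-(r * s)) (2 * k) 0 :=
    fun a ha => ⟨cocycle_mem_ker hr _ _, cocycle_mem_C2component ha⟩
  apply le_antisymm
  · intro x hx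
    obtain ⟨q, hq⟩ := exists_eq_sum_of_mem hr (k + 2) (fun i => (i, k + 1 - i, i + 1)) (by
      rintro ⟨i, j, l⟩ h1 h2
      simp only [deg, sdeg] at h1 h2
      refine ⟨i, by omega, ?_⟩
      simp only [Prod.mk.injEq, true_and]
      omega) hx.2.1
    have : x = ∑ i ∈ Finset.range (k + 2), q i • cc i (k + 1 - i) := by
      refine eq_of_fst_eq hr hs hgen hx (Submodule.sum_mem _ fun i hi => Submodule.smul_mem _ _
        (hmem i (by have := Finset.mem_range.1 hi; omega))) ?_
      rw [hq, Prod.fst_sum]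
      rfl
    rw [this]
    exact Submodule.sum_mem _ fun i hi => Submodule.smul_mem _ _ (Submodule.subset_span
      ⟨i, by have := Finset.mem_range.1 hi; omega, rfl⟩)
  · refine Submodule.span_le.2 ?_
    rintro _ ⟨a, ha, rfl⟩
    exact hmem a ha

theorem finrank_Zcomponent (k : ℕ) :
    Module.finrank K (Zcomponent (r + s) (-(r * s)) (2 * k) 0) = k + 2 := by
  have hli : LinearIndependent K fun a : Fin (k + 2) => cc a (k + 1 - a) := by
    refine LinearIndependent.of_comp (LinearMap.fst K A A) ?_
    refine (linearIndependent_mono r s hr).comp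
      (fun a : Fin (k + 2) => ((a : ℕ), k + 1 - (a : ℕ), (a : ℕ) + 1)) ?_
    intro a b hab
    exact Fin.ext (congrArg Prod.fst hab)
  have hset : {x | ∃ a : ℕ, a ≤ k + 1 ∧ x = cc a (k + 1 - a)}
      = Set.range fun a : Fin (k + 2) => cc a (k + 1 - a) := by
    ext x
    constructor
    · rintro ⟨a, ha, rfl⟩
      exact ⟨⟨a, by omega⟩, rfl⟩
    · rintro ⟨a, rfl⟩
      exact ⟨a, by omega, rfl⟩
  rw [Zcomponent_eq_span hr hs hgen, hset, finrank_span_eq_card hli, Fintype.card_fin]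

end generic

end

end DownUp

namespace DownUp

open Hochschild

section
variable {K : Type*} [Field K]
variable {r s : K}

local notation "A" => Alg (r + s) (-(r * s)) (0 : K)
local notation "𝐮" => u (r + s) (-(r * s)) (0 : K)
local notation "𝐝" => d (r + s) (-(r * s)) (0 : K)
local notation "𝐰" => w (r + s) (-(r * s)) (0 : K) r
local notation "e" => mono r s
local notation "comp" => component (r + s) (-(r * s))
local notation "δ" => d1 (r + s) (-(r * s))
local notation "cc" => cocycle (r + s) (-(r * s)) r

/-! ### Coboundaries of bidegree `(2k, 0)` -/

/-- The leading coefficient is t² - αt - β = (t - r)(t - s) at t = s^{i+1}rʲ. The value of the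
middle coefficient plays no role, and the last one vanishes for i = 0, where its monomial is
truncated. -/
theorem d1_mono_fst (hr : r ≠ 0) (i j : ℕ) : ∃ b : K,
    (δ (0, e (i, j, i + 1))).1
      = ((s ^ (i + 1) * r ^ j - r) * (s * (s ^ i * r ^ j - 1))) • e (i + 1, j, i + 2)
        + b • e (i, j + 1, i + 1)
        + (bracket r s (i + 1) * bracket r s i) • e (i - 1, j + 2, i) := by
  refine ⟨bracket r s (i + 2) + bracket r s (i + 1) * (s ^ (i + 1) * r ^ j + s ^ i * r ^ (j + 1))
    - (r + s) * (2 * bracket r s (i + 1)) + r * s * bracket r s i, ?_⟩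
  rw [d1_fst]
  simp only [mul_zero, zero_mul, zero_add]
  rcases i with _ | i
  · simp only [mul_assoc, mul_add, add_mul, mul_smul_comm, smul_mul_assoc, mono_mul_d,
      mono_mul_u r s hr, u_mul_mono, d_mul_mono r s hr, Nat.add_sub_cancel, bracket_zero, zero_smul,
      add_zero]
    have h := bracket_add_two r s 0
    match_scalars
    · ring
    · linear_combination r ^ j * h - r ^ j * r * s * bracket_zero r s
    · ring
  · simp only [mul_assoc, mul_add, add_mul, mul_smul_comm, smul_mul_assoc, mono_mul_d,
      mono_mul_u r s hr, u_mul_mono, d_mul_mono r s hr, Nat.add_sub_cancel]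
    have h := bracket_add_two r s (i + 1)
    match_scalars <;> first | ring1 | linear_combination (s * s ^ i * r ^ j) * h

variable (hr : r ≠ 0) (hs : s ≠ 0) (hgen : ∀ i j : ℤ, (i, j) ≠ (0, 0) → r ^ i * s ^ j ≠ 1)

include hs hr hgen in
-- Vanishing of a factor would mean r^{j-1}s^{i+1} = 1 or rʲsⁱ = 1; only the second needs i + j ≠ 0
-- to be a nontrivial relation.
theorem leading_coeff_ne_zero {i j : ℕ} (hij : i + j ≠ 0) :
    (s ^ (i + 1) * r ^ j - r) * (s * (s ^ i * r ^ j - 1)) ≠ 0 := by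
  refine mul_ne_zero ?_ (mul_ne_zero hs ?_)
  · intro h
    refine hgen (j - 1) (i + 1) (by simp; omega) ?_
    rw [zpow_sub₀ hr, zpow_natCast, zpow_one, ← Nat.cast_add_one, zpow_natCast, div_mul_eq_mul_div,
      div_eq_one_iff_eq hr]
    linear_combination h
  · intro h
    refine hgen j i (by simp; omega) ?_
    rw [zpow_natCast, zpow_natCast]
    linear_combination h

include hs hr hgen

/-- Both sides are cocycles of bidegree (2k, 0), so the formula for the D²U-part decides. -/
theorem d1_mono {i k : ℕ} (hi : i ≤ k) : ∃ b c : K,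
    δ (0, e (i, k - i, i + 1))
      = ((s ^ (i + 1) * r ^ (k - i) - r) * (s * (s ^ i * r ^ (k - i) - 1))) • cc (i + 1) (k - i)
        + b • cc i (k + 1 - i) + c • cc (i - 1) (k + 1 - (i - 1)) := by
  obtain ⟨b, hb⟩ := d1_mono_fst (s := s) hr i (k - i)
  refine ⟨b, bracket r s (i + 1) * bracket r s i, eq_of_fst_eq hr hs hgen (k := k) ?_ ?_ ?_⟩
  · refine ⟨d1_mem_ker _, d1_mem_C2component (Submodule.zero_mem _) (component_cast
      (mono_mem_component r s _) ?_ ?_)⟩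
    · simp only [deg]; omega
    · simp only [sdeg]; omega
  · have h1 := cocycle_mem_C2component (r := r) (s := s) (a := i + 1) (k := k) (by omega)
    rw [show k + 1 - (i + 1) = k - i by omega] at h1
    exact ⟨add_mem (add_mem (Submodule.smul_mem _ _ (cocycle_mem_ker hr _ _))
        (Submodule.smul_mem _ _ (cocycle_mem_ker hr _ _)))
        (Submodule.smul_mem _ _ (cocycle_mem_ker hr _ _)),
      add_mem (add_mem (Submodule.smul_mem _ _ h1)
        (Submodule.smul_mem _ _ (cocycle_mem_C2component (by omega))))
        (Submodule.smul_mem _ _ (cocycle_mem_C2component (by omega)))⟩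
  · rw [hb]
    rcases i with _ | i
    · simp only [bracket_zero, mul_zero, zero_smul]
      rfl
    · rw [show k - (i + 1) + 1 = k + 1 - (i + 1) by omega,
        show k - (i + 1) + 2 = k + 1 - (i + 1 - 1) by omega]
      rfl

/-- Solve `d1_mono` for its leading cocycle and induct on the index; k ≥ 1 makes the leading
coefficient invertible, also for i = 0. -/
theorem cocycle_mem_sup {a k : ℕ} (hk : 1 ≤ k) (ha : a ≤ k + 1) :
    cc a (k + 1 - a) ∈ LinearMap.range δ ⊔ Submodule.span K {cc 0 (k + 1)} := by
  induction a using Nat.strong_induction_on with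
  | _ a ih =>
    rcases a with _ | i
    · exact Submodule.mem_sup_right (Submodule.mem_span_singleton_self _)
    · obtain ⟨b, c, h⟩ := d1_mono hr hs hgen (i := i) (k := k) (by omega)
      have h0 := leading_coeff_ne_zero hr hs hgen (i := i) (j := k - i) (by omega)
      rw [show k + 1 - (i + 1) = k - i by omega, ← Submodule.smul_mem_iff _ h0]
      have : ((s ^ (i + 1) * r ^ (k - i) - r) * (s * (s ^ i * r ^ (k - i) - 1))) • cc (i + 1) (k - i)
          = δ (0, e (i, k - i, i + 1)) - b • cc i (k + 1 - i)
            - c • cc (i - 1) (k + 1 - (i - 1)) := by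
        rw [h]; abel
      rw [this]
      exact Submodule.sub_mem _ (Submodule.sub_mem _ (Submodule.mem_sup_left ⟨_, rfl⟩)
        (Submodule.smul_mem _ _ (ih i (by omega) (by omega))))
        (Submodule.smul_mem _ _ (ih (i - 1) (by omega) (by omega)))

omit hs in
-- On the monomials uⁱw^{k-i}dⁱ the map ad u is triangular with diagonal entries 1 - sⁱr^{k-i},
-- nonzero since the exponents add up to k ≥ 1.
theorem exists_commutator_eq_mono {i k : ℕ} (hk : 1 ≤ k) (hi : i ≤ k) :
    ∃ z ∈ comp (2 * k) 0, 𝐮 * z - z * 𝐮 = e (i + 1, k - i, i) := by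
  have hz : ∀ i ≤ k, e (i, k - i, i) ∈ comp (2 * k) 0 := fun i hi =>
    component_cast (mono_mem_component r s _) (by simp only [deg]; omega)
      (by simp only [sdeg]; omega)
  have hne : ∀ i ≤ k, 1 - s ^ i * r ^ (k - i) ≠ 0 := by
    intro i hi h
    refine hgen (k - i : ℕ) i (by simp; omega) ?_
    rw [zpow_natCast, zpow_natCast]
    linear_combination -h
  induction i with
  | zero =>
    refine ⟨(1 - s ^ 0 * r ^ (k - 0))⁻¹ • e (0, k - 0, 0),
      Submodule.smul_mem _ _ (hz 0 (by omega)), ?_⟩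
    rw [mul_smul_comm, smul_mul_assoc, ← smul_sub, inv_smul_eq_iff₀ (hne 0 (by omega)),
      u_mul_mono, mono_mul_u r s hr, bracket_zero]
    module
  | succ i ih =>
    obtain ⟨z, hz', h⟩ := ih (by omega)
    -- The commutator of u with the monomial also contains -`bracket r s (i + 1)` times the target
    -- of the previous step; the multiple of z cancels it.
    refine ⟨(1 - s ^ (i + 1) * r ^ (k - (i + 1)))⁻¹ •
      (e (i + 1, k - (i + 1), i + 1) + bracket r s (i + 1) • z),
      Submodule.smul_mem _ _ (add_mem (hz _ hi) (Submodule.smul_mem _ _ hz')), ?_⟩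
    rw [mul_smul_comm, smul_mul_assoc, ← smul_sub, inv_smul_eq_iff₀ (hne _ hi), mul_add, add_mul,
      mul_smul_comm, smul_mul_assoc, u_mul_mono, mono_mul_u r s hr, Nat.add_sub_cancel,
      show k - (i + 1) + 1 = k - i by omega, ← h]
    module

omit hs in
theorem exists_commutator_eq {k : ℕ} (hk : 1 ≤ k) {a : A} (ha : a ∈ comp (2 * k + 1) (0 + 1)) :
    ∃ z ∈ comp (2 * k) 0, 𝐮 * z - z * 𝐮 = a := by
  rw [component_eq_span r s hr] at ha
  induction ha using Submodule.span_induction with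
  | mem x hx =>
    obtain ⟨⟨i, j, l⟩, ⟨h1, h2⟩, rfl⟩ := hx
    simp only [deg, sdeg] at h1 h2
    obtain rfl : i = l + 1 := by omega
    obtain rfl : j = k - l := by omega
    exact exists_commutator_eq_mono hr hgen hk (by omega)
  | zero => exact ⟨0, Submodule.zero_mem _, by simp⟩
  | add x y _ _ hx hy =>
    obtain ⟨z, hz, rfl⟩ := hx
    obtain ⟨z', hz', rfl⟩ := hy
    exact ⟨z + z', add_mem hz hz', by rw [mul_add, add_mul]; abel⟩
  | smul t x _ hx =>
    obtain ⟨z, hz, rfl⟩ := hx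
    exact ⟨t • z, Submodule.smul_mem _ t hz, by rw [mul_smul_comm, smul_mul_assoc, smul_sub]⟩

/-- The leading terms of the images have positive u-exponent, whereas the D²U-part of the right-hand
side is w^{k+1}d. Triangularity then kills all coefficients of y. -/
theorem d1_ne_cocycle {k : ℕ} (hk : 1 ≤ k) {y : A} (hy : y ∈ comp (2 * k + 1) (0 - 1)) :
    δ (0, y) ≠ cc 0 (k + 1) := by
  intro h
  obtain ⟨q, rfl⟩ := exists_eq_sum_of_mem hr (k + 1) (fun i => (i, k - i, i + 1)) (by
    rintro ⟨i, j, l⟩ h1 h2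
    simp only [deg, sdeg] at h1 h2
    refine ⟨i, by omega, ?_⟩
    simp only [Prod.mk.injEq, true_and]
    omega) hy
  have hsum : ∑ i ∈ Finset.range (k + 1), q i • (δ (0, e (i, k - i, i + 1))).1
      = e (0, k + 1, 1) := by
    have h' := congrArg Prod.fst h
    have hlin : ∀ x : A, (δ (0, x)).1 = (LinearMap.fst K A A ∘ₗ δ ∘ₗ LinearMap.inr K A A) x :=
      fun x => rfl
    rw [hlin, map_sum] at h'
    simp only [map_smul] at h'
    exact h'
  -- Induction from the top index downwards: the coordinate (i + 1, k - i, i + 2) is not reached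
  -- from an index below i, and the coefficients above i are already zero.
  have hq : ∀ N, ∀ i ≤ k, k - i = N → q i = 0 := by
    intro N
    induction N using Nat.strong_induction_on with
    | _ N ih =>
      intro i hi hN
      have h' := congrArg ((monoBasis r s hr).coord (i + 1, k - i, i + 2)) hsum
      rw [map_sum, Finset.sum_eq_single i] at h'
      · obtain ⟨b, hb⟩ := d1_mono_fst (s := s) hr i (k - i)
        simp only [hb, map_add, map_smul, coord_mono, Prod.mk.injEq] at h'
        split_ifs at h' <;> try first | omega | contradiction
        have h0 := leading_coeff_ne_zero hr hs hgen (i := i) (j := k - i) (by omega)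
        simp only [smul_eq_mul, mul_one, mul_zero, add_zero, mul_eq_zero] at h'
        rw [← mul_eq_zero, ← mul_eq_zero] at h'
        exact h'.resolve_right h0
      · intro j hj hij
        have hj' := Finset.mem_range.1 hj
        rcases lt_or_gt_of_ne hij with hlt | hlt
        · obtain ⟨b, hb⟩ := d1_mono_fst (s := s) hr j (k - j)
          simp only [hb, map_add, map_smul, coord_mono, Prod.mk.injEq]
          split_ifs <;> first | omega | simp
        · rw [ih (k - j) (by omega) j (by omega) rfl]
          simp
      · simp; omega
  rw [Finset.sum_eq_zero] at hsum
  · exact (linearIndependent_mono r s hr).ne_zero (0, k + 1, 1) hsum.symm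
  · intro i hi
    rw [hq _ i (by have := Finset.mem_range.1 hi; omega) rfl, zero_smul]

/-- Subtracting d₀*(z) from a homogeneous preimage, with z chosen to remove its U-part, leaves the
case excluded by `d1_ne_cocycle`. -/
theorem cocycle_notMem_range {k : ℕ} (hk : 1 ≤ k) : cc 0 (k + 1) ∉ LinearMap.range δ := by
  intro h
  obtain ⟨a, ha, a', ha', h⟩ := exists_homogeneous_preimage hr
    (cocycle_mem_C2component (r := r) (s := s) (a := 0) (k := k) (by omega)) h
  obtain ⟨z, hz, rfl⟩ := exists_commutator_eq hr hgen hk ha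
  have hmem : a' - (𝐝 * z - z * 𝐝) ∈ comp (2 * k + 1) (0 - 1) := by
    refine Submodule.sub_mem _ ha' (Submodule.sub_mem _ ?_ ?_)
    · exact component_cast (mul_mem_component d_mem_component hz) (by ring) (by ring)
    · exact component_cast (mul_mem_component hz d_mem_component) (by ring) (by ring)
  refine d1_ne_cocycle hr hs hgen hk hmem ?_
  have h0 := d1_commutator z
  rw [← sub_zero (δ _), ← h0, ← map_sub, Prod.mk_sub_mk, sub_self] at h
  exact h

end

end DownUp

namespace DownUp

open Hochschild

/-! ### Injectivity of the comparison map -/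

section
variable {K R : Type*} [Field K] [Ring R] [Algebra K R]

/-- Left multiplication by `(a, m)` on the extension of `R` by `R` with cocycle `f`. -/
def extOp (f : Cochain2 K R) (a m : R) : Module.End K (R × R) where
  toFun x := (a * x.1, a * x.2 + f a x.1 + m * x.1)
  map_add' x y := by
    ext
    · simp [mul_add]
    · simp only [Prod.fst_add, Prod.snd_add, mul_add, map_add]; abel
  map_smul' t x := by
    ext
    · simp
    · simp [smul_add]

theorem extOp_add (f : Cochain2 K R) (a m a' m' : R) :
    extOp f a m + extOp f a' m' = extOp f (a + a') (m + m') := by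
  refine LinearMap.ext fun x => Prod.ext ?_ ?_
  · simp [extOp, add_mul]
  · simp only [extOp, LinearMap.add_apply, LinearMap.coe_mk, AddHom.coe_mk, Prod.snd_add, add_mul,
      map_add]
    abel

theorem extOp_smul (f : Cochain2 K R) (t : K) (a m : R) :
    t • extOp f a m = extOp f (t • a) (t • m) := by
  refine LinearMap.ext fun x => Prod.ext ?_ ?_ <;> simp [extOp]

/-- The cocycle is not assumed normalised, so the unit of the extension is (1, -f(1, 1)). -/
theorem extOp_one {f : Cochain2 K R} (hf : f ∈ Z2 K R) : 1 = extOp f 1 (-f 1 1) := by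
  have hZ : ∀ a b c : R, a * f b c - f (a * b) c + f a (b * c) - f a b * c = 0 := hf
  refine LinearMap.ext fun x => Prod.ext ?_ ?_
  · simp [extOp]
  · have := hZ 1 1 x.1
    simp only [one_mul, sub_self, zero_add] at this
    simp only [extOp, LinearMap.coe_mk, AddHom.coe_mk, Module.End.one_apply, one_mul, neg_mul]
    linear_combination (norm := abel) -this

theorem extOp_mul {f : Cochain2 K R} (hf : f ∈ Z2 K R) (a m a' m' : R) :
    extOp f a m * extOp f a' m' = extOp f (a * a') (a * m' + m * a' + f a a') := by
  have hZ : ∀ a b c : R, a * f b c - f (a * b) c + f a (b * c) - f a b * c = 0 := hf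
  refine LinearMap.ext fun x => Prod.ext ?_ ?_
  · simp [extOp, mul_assoc]
  · have := hZ a a' x.1
    simp only [extOp, Module.End.mul_apply, LinearMap.coe_mk, AddHom.coe_mk, mul_add, add_mul,
      mul_assoc]
    linear_combination (norm := abel) this

end

section
variable {K : Type*} [Field K] {α β : K}

/-- If `restrict f` = d₁*(p, q), then (u, -p) and (d, -q) satisfy the relations of A in the
extension defined by f. They give a multiplicative section a ↦ (a, -g a), and its multiplicativity
says that f is the coboundary of g. -/
theorem mem_B2_of_restrict_mem_range {f : Cochain2 K (Alg α β 0)} (hf : f ∈ Z2 K (Alg α β 0))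
    (h : restrict α β f ∈ LinearMap.range (d1 α β)) : f ∈ B2 K (Alg α β 0) := by
  have hZ : ∀ a b c : Alg α β 0,
    a * f b c - f (a * b) c + f a (b * c) - f a b * c = 0 := hf
  obtain ⟨⟨p, q⟩, hpq⟩ := h
  have h1 := congrArg Prod.fst hpq
  have h2 := congrArg Prod.snd hpq
  rw [d1_fst] at h1
  rw [d1_snd] at h2
  simp only [restrict, LinearMap.coe_mk, AddHom.coe_mk] at h1 h2
  have R1 := rel_ddu α β 0
  have R2 := rel_duu α β 0
  have hex : ∃ ρ : Alg α β 0 →ₐ[K] Module.End K (Alg α β 0 × Alg α β 0),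
      ρ (u α β 0) = extOp f (u α β 0) (-p) ∧ ρ (d α β 0) = extOp f (d α β 0) (-q) := by
    refine exists_algHom α β _ _ ?_ ?_
    · simp only [extOp_mul hf, extOp_add, extOp_smul]
      generalize u α β 0 = u at *
      generalize d α β 0 = d at *
      congr 1
      · simpa using R1
      · have z1 := hZ d d u
        have z2 := hZ d u d
        have z3 := hZ u d d
        simp only [add_mul, neg_mul, mul_neg, mul_assoc, smul_add] at *
        linear_combination (norm := module) -h1 - z1 + α • z2 + β • z3
    · simp only [extOp_mul hf, extOp_add, extOp_smul]
      generalize u α β 0 = u at *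
      generalize d α β 0 = d at *
      congr 1
      · simpa using R2
      · have z1 := hZ d u u
        have z2 := hZ u d u
        have z3 := hZ u u d
        simp only [add_mul, neg_mul, mul_neg, mul_assoc, smul_add] at *
        linear_combination (norm := module) -h2 - z1 + α • z2 + β • z3
  obtain ⟨ρ, hu, hd⟩ := hex
  have hρ : ∀ a, ∃ m, ρ a = extOp f a m := by
    intro a
    induction a using induction_left with
    | one => exact ⟨_, (map_one ρ).trans (extOp_one hf)⟩
    | add a b ha hb =>
      obtain ⟨m, ha⟩ := ha
      obtain ⟨m', hb⟩ := hb
      exact ⟨m + m', by rw [map_add, ha, hb, extOp_add]⟩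
    | smul t a ha =>
      obtain ⟨m, ha⟩ := ha
      exact ⟨t • m, by rw [map_smul, ha, extOp_smul]⟩
    | hu a ha =>
      obtain ⟨m, ha⟩ := ha
      exact ⟨_, by rw [map_mul, ha, hu, extOp_mul hf]⟩
    | hd a ha =>
      obtain ⟨m, ha⟩ := ha
      exact ⟨_, by rw [map_mul, ha, hd, extOp_mul hf]⟩
  -- The operator of (a, m) sends (1, 0) to (a, f(a, 1) + m), so subtracting from f(a, 1) isolates
  -- -m.
  let g : Alg α β 0 →ₗ[K] Alg α β 0 :=
    f.flip 1 - LinearMap.snd K _ _ ∘ₗ LinearMap.applyₗ ((1 : Alg α β 0), (0 : Alg α β 0)) ∘ₗ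
      ρ.toLinearMap
  have hg : ∀ a m, ρ a = extOp f a m → m = -g a := by
    intro a m h
    simp [g, h, extOp]
  refine ⟨g, fun a b => ?_⟩
  obtain ⟨m, ha⟩ := hρ a
  obtain ⟨m', hb⟩ := hρ b
  have hab := map_mul ρ a b
  rw [ha, hb, extOp_mul hf] at hab
  have h3 := hg _ _ hab
  rw [hg a m ha, hg b m' hb] at h3
  rw [mul_neg, neg_mul] at h3
  linear_combination (norm := abel) h3

theorem comparison_injective : Function.Injective (comparison α β) := by
  rw [← LinearMap.ker_eq_bot, LinearMap.ker_eq_bot']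
  intro c hc
  obtain ⟨f, rfl⟩ := Submodule.Quotient.mk_surjective _ c
  rw [Submodule.Quotient.mk_eq_zero]
  have h : (Submodule.Quotient.mk _ : H2 α β) = 0 := hc
  rw [Submodule.Quotient.mk_eq_zero] at h
  exact mem_B2_of_restrict_mem_range f.2 h

end

end DownUp

namespace DownUp

open Hochschild

/-! ### Hochschild cocycles from deformations of the left regular representation -/

section
variable {K : Type*} [Field K] {α β : K}

/-- Left multiplication by `a` on `A ⊕ A`, with `h` as lower left entry. -/
def deformedMul (a : Alg α β 0) (h : Alg α β 0 →ₗ[K] Alg α β 0) :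
    Module.End K (Alg α β 0 × Alg α β 0) where
  toFun x := (a * x.1, a * x.2 + h x.1)
  map_add' x y := by
    ext
    · simp [mul_add]
    · simp only [Prod.fst_add, Prod.snd_add, mul_add, map_add]; abel
  map_smul' t x := by
    ext
    · simp
    · simp [smul_add]

/-- The representation of the free algebra on `A ⊕ A` by which `u` acts as by multiplication and `d`
acts with `h` as lower left entry. -/
def deformation (h : Alg α β 0 →ₗ[K] Alg α β 0) :
    FreeAlgebra K Gen →ₐ[K] Module.End K (Alg α β 0 × Alg α β 0) :=
  FreeAlgebra.lift K fun g =>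
    Gen.casesOn g (deformedMul (u α β 0) 0) (deformedMul (d α β 0) h)

variable (h : Alg α β 0 →ₗ[K] Alg α β 0)

theorem deformation_u :
    deformation h (FreeAlgebra.ι K Gen.u) = deformedMul (u α β 0) 0 := by
  simp [deformation]

theorem deformation_d :
    deformation h (FreeAlgebra.ι K Gen.d) = deformedMul (d α β 0) h := by
  simp [deformation]

theorem deformation_apply (x : FreeAlgebra K Gen) (b m : Alg α β 0) :
    deformation h x (b, m)
      = (proj α β 0 x * b, proj α β 0 x * m + (deformation h x (b, 0)).2) := by
  induction x using FreeAlgebra.induction generalizing b m with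
  | grade0 t =>
    rw [AlgHom.commutes, AlgHom.commutes, ← Algebra.smul_def, ← Algebra.smul_def]
    simp
  | grade1 g =>
    cases g
    · rw [deformation_u]
      simp [deformedMul, u, gen]
    · rw [deformation_d]
      simp [deformedMul, d, gen]
  | mul x y hx hy =>
    simp only [map_mul, Module.End.mul_apply]
    rw [hy, hx, hy b 0, hx (proj α β 0 y * b) (_ + _)]
    simp only [mul_add, mul_zero, mul_assoc, zero_add, add_assoc]
  | add x y hx hy =>
    simp only [map_add, LinearMap.add_apply]
    rw [hx, hy]
    simp only [Prod.mk_add_mk, Prod.snd_add, add_mul, Prod.mk.injEq, true_and]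
    abel

theorem deformation_apply_snd (x : FreeAlgebra K Gen) (v : Alg α β 0 × Alg α β 0)
    (m : Alg α β 0) :
    deformation h x (v + (0, m)) = deformation h x v + (0, proj α β 0 x * m) := by
  rw [map_add, deformation_apply h x 0 m, mul_zero]
  congr 2
  have : deformation h x ((0 : Alg α β 0), (0 : Alg α β 0)) = 0 := map_zero _
  rw [this]
  simp

theorem deformation_fst (x : FreeAlgebra K Gen) (v : Alg α β 0 × Alg α β 0) :
    (deformation h x v).1 = proj α β 0 x * v.1 := by
  rw [← Prod.mk.eta (p := v), deformation_apply]

variable {h}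

/-- Operators whose only entry is a left multiplication in the lower left corner are stable under
composition with deformed operators on both sides. So if the defining relations hold up to such
errors, all their consequences do. -/
theorem deformation_eq_add
    (hrel : ∀ x x', Rel α β 0 x x' → ∃ y, ∀ v, deformation h x v = deformation h x' v + (0, y * v.1))
    {x x' : FreeAlgebra K Gen} (hx : proj α β 0 x = proj α β 0 x') :
    ∃ y, ∀ v, deformation h x v = deformation h x' v + (0, y * v.1) := by
  -- Equality in the quotient unfolds to the equivalence relation generated by the relations, on
  -- which one can induct.
  have h0 : Relation.EqvGen (RingQuot.Rel (Rel α β 0)) x x' := by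
    apply Quot.eqvGen_exact
    have h1 : RingQuot.mkRingHom (Rel α β 0) x = RingQuot.mkRingHom (Rel α β 0) x' := by
      rw [← RingQuot.mkAlgHom_coe K]
      exact hx
    simpa [RingQuot.mkRingHom_def] using h1
  clear hx
  induction h0 with
  | rel x x' hx =>
    induction hx with
    | of hx => exact hrel _ _ hx
    | @add_left a b c _ ih =>
      obtain ⟨y, hy⟩ := ih
      refine ⟨y, fun v => ?_⟩
      rw [map_add, map_add, LinearMap.add_apply, LinearMap.add_apply, hy]
      abel
    | @mul_left a b c _ ih =>
      obtain ⟨y, hy⟩ := ih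
      refine ⟨y * proj α β 0 c, fun v => ?_⟩
      rw [map_mul, map_mul, Module.End.mul_apply, Module.End.mul_apply, hy, deformation_fst,
        mul_assoc]
    | @mul_right a b c _ ih =>
      obtain ⟨y, hy⟩ := ih
      refine ⟨proj α β 0 a * y, fun v => ?_⟩
      rw [map_mul, map_mul, Module.End.mul_apply, Module.End.mul_apply, hy, deformation_apply_snd,
        mul_assoc]
  | refl x => exact ⟨0, fun v => by simp⟩
  | symm x x' _ ih =>
    obtain ⟨y, hy⟩ := ih
    exact ⟨-y, fun v => by rw [hy v]; ext <;> simp⟩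
  | trans x x' x'' _ _ ih ih' =>
    obtain ⟨y, hy⟩ := ih
    obtain ⟨y', hy'⟩ := ih'
    refine ⟨y' + y, fun v => ?_⟩
    rw [hy, hy', add_assoc]
    congr 1
    ext <;> simp [add_mul]

/-- The failure of `deformation h ∘ σ` to be multiplicative. -/
def deformationCochain (h : Alg α β 0 →ₗ[K] Alg α β 0)
    (σ : Alg α β 0 →ₗ[K] FreeAlgebra K Gen) : Cochain2 K (Alg α β 0) :=
  LinearMap.mk₂ K (fun a b => (deformation h (σ a * σ b) (1, 0)).2
      - (deformation h (σ (a * b)) (1, 0)).2)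
    (fun a a' b => by
      simp only [map_add, add_mul, LinearMap.add_apply, Prod.snd_add]; abel)
    (fun t a b => by
      simp only [map_smul, smul_mul_assoc, LinearMap.smul_apply, Prod.smul_snd, smul_sub])
    (fun a b b' => by
      simp only [map_add, mul_add, LinearMap.add_apply, Prod.snd_add]; abel)
    (fun t a b => by
      simp only [map_smul, mul_smul_comm, LinearMap.smul_apply, Prod.smul_snd, smul_sub])

theorem deformationCochain_apply (σ : Alg α β 0 →ₗ[K] FreeAlgebra K Gen) (a b : Alg α β 0) :
    deformationCochain h σ a b = (deformation h (σ a * σ b) (1, 0)).2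
      - (deformation h (σ (a * b)) (1, 0)).2 := rfl

section
variable {σ : Alg α β 0 →ₗ[K] FreeAlgebra K Gen} (hσ : ∀ a, proj α β 0 (σ a) = a)
  (hrel : ∀ x x', Rel α β 0 x x' → ∃ y, ∀ v, deformation h x v = deformation h x' v + (0, y * v.1))
include hσ hrel

theorem deformation_section_mul (a b : Alg α β 0) (v : Alg α β 0 × Alg α β 0) :
    deformation h (σ a) (deformation h (σ b) v)
      = deformation h (σ (a * b)) v + (0, deformationCochain h σ a b * v.1) := by
  obtain ⟨y, hy⟩ := deformation_eq_add hrel (x := σ a * σ b) (x' := σ (a * b))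
    (by rw [map_mul, hσ, hσ, hσ])
  have : deformationCochain h σ a b = y := by
    rw [deformationCochain_apply, hy]
    simp
  rw [this, ← hy, map_mul, Module.End.mul_apply]

/-- The cochain is a factor set: the product of three operators is reduced in the two possible ways.
-/
theorem deformationCochain_mem_Z2 : deformationCochain h σ ∈ Z2 K (Alg α β 0) := by
  intro a b c
  have h1 := deformation_section_mul hσ hrel a b (deformation h (σ c) (1, 0))
  rw [deformation_section_mul hσ hrel b c, deformation_section_mul hσ hrel (a * b) c,
    deformation_apply_snd, deformation_section_mul hσ hrel a (b * c), deformation_fst, hσ, hσ] at h1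
  have h2 := congrArg Prod.snd h1
  simp only [Prod.snd_add, mul_one, mul_assoc] at h2
  linear_combination (norm := abel) h2

theorem deformationCochain_word (a b c : Alg α β 0) :
    deformationCochain h σ a (b * c) + a * deformationCochain h σ b c
      = (deformation h (σ a) (deformation h (σ b) (deformation h (σ c) (1, 0)))).2
        - (deformation h (σ (a * (b * c))) (1, 0)).2 := by
  rw [deformation_section_mul hσ hrel b c, deformation_apply_snd,
    deformation_section_mul hσ hrel a (b * c), hσ]
  simp only [Prod.snd_add, mul_one]
  abel

/-- By `deformationCochain_word` each word contributes its deformed operator minus that of its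
chosen lift, applied to (1, 0). The lifts cancel because σ is linear and the relation holds in A,
leaving the error of the relation. -/
theorem restrict_deformationCochain (hu : σ (u α β 0) = FreeAlgebra.ι K Gen.u)
    (hd : σ (d α β 0) = FreeAlgebra.ι K Gen.d) {y₁ y₂ : Alg α β 0}
    (h1 : h (d α β 0 * u α β 0) + d α β 0 * h (u α β 0)
      - α • (h (u α β 0 * d α β 0) + d α β 0 * (u α β 0 * h 1))
      - β • (u α β 0 * h (d α β 0) + u α β 0 * (d α β 0 * h 1)) = y₁)
    (h2 : h (u α β 0 * u α β 0) - α • (u α β 0 * h (u α β 0))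
      - β • (u α β 0 * (u α β 0 * h 1)) = y₂) :
    restrict α β (deformationCochain h σ) = (y₁, y₂) := by
  have R1 := rel_ddu α β 0
  have R2 := rel_duu α β 0
  rw [zero_smul, add_zero] at R1 R2
  have e1 := congrArg (fun x => (deformation h (σ x) (1, 0)).2) R1
  have e2 := congrArg (fun x => (deformation h (σ x) (1, 0)).2) R2
  simp only [map_add, map_smul, LinearMap.add_apply, LinearMap.smul_apply, Prod.snd_add,
    Prod.smul_snd, mul_assoc] at e1 e2
  refine Prod.ext ?_ ?_
  · simp only [restrict, LinearMap.coe_mk, AddHom.coe_mk]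
    simp only [deformationCochain_word hσ hrel, hu, hd, deformation_u, deformation_d]
    simp only [deformedMul, LinearMap.coe_mk, AddHom.coe_mk, LinearMap.zero_apply, mul_zero,
      add_zero, mul_one, zero_add, mul_add]
    linear_combination (norm := module) h1 - e1
  · simp only [restrict, LinearMap.coe_mk, AddHom.coe_mk]
    simp only [deformationCochain_word hσ hrel, hu, hd, deformation_u, deformation_d]
    simp only [deformedMul, LinearMap.coe_mk, AddHom.coe_mk, LinearMap.zero_apply, mul_zero,
      add_zero, mul_one, zero_add]
    linear_combination (norm := module) h2 - e2

end

theorem deformation_rel {y₁ y₂ : Alg α β 0}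
    (h1 : ∀ b, h (d α β 0 * (u α β 0 * b)) + d α β 0 * h (u α β 0 * b)
      - α • (h (u α β 0 * (d α β 0 * b)) + d α β 0 * (u α β 0 * h b))
      - β • (u α β 0 * h (d α β 0 * b) + u α β 0 * (d α β 0 * h b)) = y₁ * b)
    (h2 : ∀ b, h (u α β 0 * (u α β 0 * b)) - α • (u α β 0 * h (u α β 0 * b))
      - β • (u α β 0 * (u α β 0 * h b)) = y₂ * b) (x x' : FreeAlgebra K Gen)
    (hx : Rel α β 0 x x') :
    ∃ y, ∀ v, deformation h x v = deformation h x' v + (0, y * v.1) := by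
  have R1 := rel_ddu α β 0
  have R2 := rel_duu α β 0
  rw [zero_smul, add_zero] at R1 R2
  cases hx with
  | ddu =>
    refine ⟨y₁, fun v => ?_⟩
    have e1 := congrArg (· * v.1) R1
    have e2 := congrArg (· * v.2) R1
    simp only [map_add, map_mul, map_smul, deformation_u, deformation_d, zero_smul, add_zero,
      LinearMap.add_apply, LinearMap.smul_apply, Module.End.mul_apply]
    simp only [deformedMul, LinearMap.coe_mk, AddHom.coe_mk, LinearMap.zero_apply, add_zero,
      add_mul, smul_mul_assoc, mul_assoc] at *
    refine Prod.ext ?_ ?_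
    · simp only [Prod.fst_add, Prod.smul_fst, add_zero]
      exact e1
    · simp only [Prod.snd_add, Prod.smul_snd, mul_add]
      linear_combination (norm := module) e2 + h1 v.1
  | duu =>
    refine ⟨y₂, fun v => ?_⟩
    have e1 := congrArg (· * v.1) R2
    have e2 := congrArg (· * v.2) R2
    simp only [map_add, map_mul, map_smul, deformation_u, deformation_d, zero_smul, add_zero,
      LinearMap.add_apply, LinearMap.smul_apply, Module.End.mul_apply]
    simp only [deformedMul, LinearMap.coe_mk, AddHom.coe_mk, LinearMap.zero_apply, add_zero,
      add_mul, smul_mul_assoc, mul_assoc] at *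
    refine Prod.ext ?_ ?_
    · simp only [Prod.fst_add, Prod.smul_fst, add_zero]
      exact e1
    · simp only [Prod.snd_add, Prod.smul_snd, mul_add]
      linear_combination (norm := module) e2 + h2 v.1

end

end DownUp

namespace DownUp

open Hochschild

section
variable {K : Type*} [Field K]
variable (r s : K)

local notation "A" => Alg (r + s) (-(r * s)) (0 : K)
local notation "𝐮" => u (r + s) (-(r * s)) (0 : K)
local notation "𝐝" => d (r + s) (-(r * s)) (0 : K)
local notation "𝐰" => w (r + s) (-(r * s)) (0 : K) r
local notation "e" => mono r s
local notation "comp" => component (r + s) (-(r * s))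

/-! ### The deformation replacing `dw = r wd` by `dw = r (w + ε wᵐ⁺¹) d` -/

/-- The first order terms in the iterates of the deformed automorphism. -/
def iterTerm (r : K) (m : ℕ) : ℕ → K
  | 0 => 0
  | i + 1 => r * iterTerm r m i + r ^ ((m + 1) * i)

/-- The first order terms in the commutators of `d` with powers of `u`. -/
def bracketTerm (r s : K) (m : ℕ) : ℕ → K
  | 0 => 0
  | i + 1 => s * bracketTerm r s m i + iterTerm r m i

theorem iterTerm_succ (m i : ℕ) :
    iterTerm r m (i + 1) = r * iterTerm r m i + r ^ ((m + 1) * i) := rfl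

/-- Put φ(w) = r(w + εw^{m+1}). Then `iterTerm r m i` is the coefficient of εw^{m+1} in r⁻¹φⁱ(w),
and the two recursions come from φ^{i+1} = φⁱ ∘ φ = φ ∘ φⁱ. -/
theorem iterTerm_succ' (m i : ℕ) :
    iterTerm r m (i + 1) = r ^ (m + 1) * iterTerm r m i + r ^ i := by
  induction i with
  | zero => simp [iterTerm]
  | succ i ih =>
    rw [iterTerm_succ, iterTerm_succ r m i]
    rw [iterTerm_succ] at ih
    linear_combination r * ih

theorem iterTerm_zero (m : ℕ) : iterTerm r m 0 = 0 := rfl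

@[simp] theorem bracketTerm_zero (m : ℕ) : bracketTerm r s m 0 = 0 := rfl

theorem bracketTerm_succ (m i : ℕ) :
    bracketTerm r s m (i + 1) = s * bracketTerm r s m i + iterTerm r m i := rfl

/-- The first order term in the deformed action of `d` on the monomial basis. -/
noncomputable def deformD (hr : r ≠ 0) (m : ℕ) : A →ₗ[K] A :=
  (monoBasis r s hr).constr K fun t =>
    (s ^ t.1 * (t.2.1 * r ^ t.2.1)) • e (t.1, t.2.1 + m, t.2.2 + 1)
      + bracketTerm r s m t.1 • e (t.1 - 1, t.2.1 + m + 1, t.2.2)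

/-- The coefficients are the ε-terms of d·uⁱwʲdᵏ under the rules dw = φ(w)d, wu = uφ(w), du = s ud +
r⁻¹w: the factor j rʲ comes from φ(w)ʲ, and `bracketTerm` from the sum of the s^{i-1-l}r⁻¹φˡ(w). -/
theorem deformD_mono (hr : r ≠ 0) (m i j k : ℕ) : deformD r s hr m (e (i, j, k))
    = (s ^ i * (j * r ^ j)) • e (i, j + m, k + 1)
      + bracketTerm r s m i • e (i - 1, j + m + 1, k) := by
  have h := (monoBasis r s hr).constr_basis K
    (fun t => (s ^ t.1 * (t.2.1 * r ^ t.2.1)) • e (t.1, t.2.1 + m, t.2.2 + 1)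
      + bracketTerm r s m t.1 • e (t.1 - 1, t.2.1 + m + 1, t.2.2)) (i, j, k)
  rwa [monoBasis_apply] at h

theorem linearMap_eq_of_mono (hr : r ≠ 0) {f g : A →ₗ[K] A}
    (h : ∀ i j k, f (e (i, j, k)) = g (e (i, j, k))) : f = g :=
  (monoBasis r s hr).ext fun ⟨i, j, k⟩ => by simpa using h i j k

/-- Under the deformed rules du² - α udu - β u²d equals r⁻¹wu - uw = u(r⁻¹φ(w) - w) = ε uw^{m+1}. -/
theorem deformD_duu (hr : r ≠ 0) (m : ℕ) (b : A) :
    deformD r s hr m (𝐮 * (𝐮 * b)) - (r + s) • (𝐮 * deformD r s hr m (𝐮 * b))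
      - (-(r * s)) • (𝐮 * (𝐮 * deformD r s hr m b)) = 𝐮 * 𝐰 ^ (m + 1) * b := by
  let L := LinearMap.mulLeft K 𝐮
  let h := deformD r s hr m
  have key : h ∘ₗ L ∘ₗ L - (r + s) • (L ∘ₗ h ∘ₗ L) - (-(r * s)) • (L ∘ₗ L ∘ₗ h)
      = LinearMap.mulLeft K (𝐮 * 𝐰 ^ (m + 1)) := by
    refine linearMap_eq_of_mono r s hr fun i j k => ?_
    simp only [LinearMap.sub_apply, LinearMap.smul_apply, LinearMap.comp_apply, L, h,
      LinearMap.mulLeft_apply, u_mul_mono, deformD_mono, mul_assoc, w_pow_mul_mono, mul_add,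
      mul_smul_comm, Nat.add_sub_cancel]
    have h1 := iterTerm_succ r m i
    have h2 := bracketTerm_succ r s m i
    have h3 := bracketTerm_succ r s m (i + 1)
    rcases i with _ | i
    · simp only [bracketTerm_zero, zero_smul, add_zero] at *
      match_scalars
      · ring
      · linear_combination h1 + h3 - r * h2
    · simp only [Nat.add_sub_cancel]
      match_scalars
      · ring
      · linear_combination h1 + h3 - r * h2
  exact LinearMap.congr_fun key b

/-- Under the deformed rules d²u - α dud - β ud² equals r⁻¹dw - wd = (r⁻¹φ(w) - w)d = ε w^{m+1}d. -/
theorem deformD_ddu (hr : r ≠ 0) (m : ℕ) (b : A) :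
    deformD r s hr m (𝐝 * (𝐮 * b)) + 𝐝 * deformD r s hr m (𝐮 * b)
      - (r + s) • (deformD r s hr m (𝐮 * (𝐝 * b)) + 𝐝 * (𝐮 * deformD r s hr m b))
      - (-(r * s)) • (𝐮 * deformD r s hr m (𝐝 * b) + 𝐮 * (𝐝 * deformD r s hr m b))
      = 𝐰 ^ (m + 1) * 𝐝 * b := by
  let L := LinearMap.mulLeft K 𝐮
  let D := LinearMap.mulLeft K 𝐝
  let h := deformD r s hr m
  have key : h ∘ₗ D ∘ₗ L + D ∘ₗ h ∘ₗ L - (r + s) • (h ∘ₗ L ∘ₗ D + D ∘ₗ L ∘ₗ h)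
      - (-(r * s)) • (L ∘ₗ h ∘ₗ D + L ∘ₗ D ∘ₗ h) = LinearMap.mulLeft K (𝐰 ^ (m + 1) * 𝐝) := by
    refine linearMap_eq_of_mono r s hr fun i j k => ?_
    simp only [LinearMap.sub_apply, LinearMap.add_apply, LinearMap.smul_apply,
      LinearMap.comp_apply, L, D, h, LinearMap.mulLeft_apply, u_mul_mono, d_mul_mono r s hr,
      map_add, map_smul, deformD_mono, mul_assoc, w_pow_mul_mono, mul_add, mul_smul_comm,
      Nat.add_sub_cancel]
    have p1 := iterTerm_succ r m i
    have p1' := iterTerm_succ' r m i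
    have t1 := bracketTerm_succ r s m i
    have g1 := bracket_succ r s i
    have hinv := mul_inv_cancel₀ hr
    have e1 : j + 1 + m = j + m + 1 := by omega
    have e2 : j + (m + 1) = j + m + 1 := by omega
    have e3 : j + 1 + (m + 1) = j + m + 1 + 1 := by omega
    simp only [e1, e2, e3]
    -- Two applications of d can lower the u-exponent twice, so i = 0 and i = 1, where truncation
    -- interferes, are treated apart from i ≥ 2.
    rcases i with _ | i
    · simp only [bracketTerm_zero, bracket_zero, iterTerm_zero, zero_smul, add_zero] at *
      generalize r⁻¹ = q at *
      match_scalars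
      · ring
      · linear_combination r ^ j * (r ^ (m + 1) - r) * t1 + r ^ (j + 1) * g1
          + r ^ j * (p1 - p1') + r ^ j * hinv
    · have p0 := iterTerm_succ r m i
      have t0 := bracketTerm_succ r s m i
      have g2 := bracket_add_two r s i
      rcases i with _ | i
      · simp only [bracketTerm_zero, bracket_zero, iterTerm_zero, zero_smul, add_zero,
          Nat.add_sub_cancel] at *
        generalize r⁻¹ = q at *
        match_scalars
        · ring
        · linear_combination s * r ^ j * (r ^ (m + 1) - r) * t1
            + s * r ^ (j + 1) * g1 + s * r ^ j * (p1 - p1') + s * r ^ (j + 1) * hinv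
        · linear_combination bracketTerm r s m 1 * g2 + bracket r s 1 * (t1 - r * t0 + p0)
      · simp only [Nat.add_sub_cancel]
        generalize r⁻¹ = q at *
        match_scalars
        · ring
        · linear_combination s ^ (i + 2) * r ^ j * (r ^ (m + 1) - r) * t1
            + s ^ (i + 2) * r ^ (j + 1) * g1
            + s ^ (i + 2) * r ^ j * (p1 - p1') + s ^ (i + 2) * r ^ (j + i + 2) * hinv
        · linear_combination bracketTerm r s m (i + 2) * g2 + bracket r s (i + 2) * (t1 - r * t0 + p0)
  exact LinearMap.congr_fun key b

theorem deformD_mem (hr : r ≠ 0) (m : ℕ) {n p : ℤ} {a : A} (ha : a ∈ comp n p) :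
    deformD r s hr m a ∈ comp (n + 1 + 2 * m) (p - 1) := by
  rw [component_eq_span r s hr] at ha
  induction ha using Submodule.span_induction with
  | mem x hx =>
    obtain ⟨⟨i, j, k⟩, ⟨h1, h2⟩, rfl⟩ := hx
    simp only [deg, sdeg] at h1 h2
    rw [deformD_mono]
    refine add_mem (Submodule.smul_mem _ _ (component_cast (mono_mem_component r s _) ?_ ?_)) ?_
    · simp only [deg]; omega
    · simp only [sdeg]; omega
    · rcases i with _ | i
      · simp
      · refine Submodule.smul_mem _ _ (component_cast (mono_mem_component r s _) ?_ ?_)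
        · simp only [deg]; omega
        · simp only [sdeg]; omega
  | zero => simp
  | add x y _ _ hx hy => rw [map_add]; exact add_mem hx hy
  | smul t x _ hx => rw [map_smul]; exact Submodule.smul_mem _ t hx

end

end DownUp

namespace DownUp

open Hochschild

/-! ### Homogeneity -/

section
variable {K : Type*} [Field K]

section
variable {α β : K}

/-- Operators on `A ⊕ A`, the second summand shifted by `N`, that raise the bidegree by `(n, p)`. -/
def homogOps (α β : K) (N n p : ℤ) : Submodule K (Module.End K (Alg α β 0 × Alg α β 0)) where
  carrier := {T | ∀ n' p' : ℤ, ∀ v ∈ (component α β n' p').prod (component α β (n' + N) p'),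
    T v ∈ (component α β (n' + n) (p' + p)).prod (component α β (n' + n + N) (p' + p))}
  add_mem' := fun hS hT n' p' v hv => add_mem (hS n' p' v hv) (hT n' p' v hv)
  zero_mem' := fun _ _ _ _ => Submodule.zero_mem _
  smul_mem' := fun t _ hT n' p' v hv => Submodule.smul_mem _ t (hT n' p' v hv)

theorem homogOps_cast {N n p n' p' : ℤ} {T : Module.End K (Alg α β 0 × Alg α β 0)}
    (hT : T ∈ homogOps α β N n p) (hn : n = n') (hp : p = p') : T ∈ homogOps α β N n' p' :=
  hn ▸ hp ▸ hT

theorem mul_mem_homogOps {N n p n' p' : ℤ} {S T : Module.End K (Alg α β 0 × Alg α β 0)}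
    (hS : S ∈ homogOps α β N n p) (hT : T ∈ homogOps α β N n' p') :
    S * T ∈ homogOps α β N (n + n') (p + p') := by
  intro a b v hv
  have := hS _ _ _ (hT a b v hv)
  rwa [show a + n' + n = a + (n + n') by ring, show b + p' + p = b + (p + p') by ring] at this

theorem pow_mem_homogOps {N n p : ℤ} {T : Module.End K (Alg α β 0 × Alg α β 0)}
    (hT : T ∈ homogOps α β N n p) (i : ℕ) : T ^ i ∈ homogOps α β N (i * n) (i * p) := by
  induction i with
  | zero =>
    intro a b v hv
    simpa using hv
  | succ i ih =>
    rw [pow_succ]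
    exact homogOps_cast (mul_mem_homogOps ih hT) (by push_cast; ring) (by push_cast; ring)

theorem deformedMul_mem_homogOps {N n p : ℤ} {a : Alg α β 0} {h : Alg α β 0 →ₗ[K] Alg α β 0}
    (ha : a ∈ component α β n p)
    (hh : ∀ n' p', ∀ b ∈ component α β n' p', h b ∈ component α β (n' + n + N) (p' + p)) :
    deformedMul a h ∈ homogOps α β N n p := fun n' p' v hv =>
  ⟨component_cast (mul_mem_component ha hv.1) (by ring) (by ring),
    add_mem (component_cast (mul_mem_component ha hv.2) (by ring) (by ring)) (hh _ _ _ hv.1)⟩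

end

variable (r s : K)

local notation "A" => Alg (r + s) (-(r * s)) (0 : K)
local notation "𝐮" => u (r + s) (-(r * s)) (0 : K)
local notation "𝐝" => d (r + s) (-(r * s)) (0 : K)
local notation "𝐰" => w (r + s) (-(r * s)) (0 : K) r
local notation "e" => mono r s
local notation "comp" => component (r + s) (-(r * s))

/-- The lift of `w` to the free algebra. -/
def freeW : FreeAlgebra K Gen :=
  (-(r * s)) • (FreeAlgebra.ι K Gen.u * FreeAlgebra.ι K Gen.d)
    + r • (FreeAlgebra.ι K Gen.d * FreeAlgebra.ι K Gen.u)

/-- The linear section of the projection from the free algebra determined by the monomial basis. -/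
noncomputable def monoSection (hr : r ≠ 0) : A →ₗ[K] FreeAlgebra K Gen :=
  (monoBasis r s hr).constr K fun t =>
    FreeAlgebra.ι K Gen.u ^ t.1 * freeW r s ^ t.2.1 * FreeAlgebra.ι K Gen.d ^ t.2.2

theorem monoSection_mono (hr : r ≠ 0) (t : ℕ × ℕ × ℕ) : monoSection r s hr (e t)
    = FreeAlgebra.ι K Gen.u ^ t.1 * freeW r s ^ t.2.1 * FreeAlgebra.ι K Gen.d ^ t.2.2 := by
  have h := (monoBasis r s hr).constr_basis K (fun t : ℕ × ℕ × ℕ =>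
    FreeAlgebra.ι K Gen.u ^ t.1 * freeW r s ^ t.2.1 * FreeAlgebra.ι K Gen.d ^ t.2.2) t
  rwa [monoBasis_apply] at h

theorem proj_monoSection (hr : r ≠ 0) (a : A) :
    proj (r + s) (-(r * s)) 0 (monoSection r s hr a) = a := by
  have : (proj (r + s) (-(r * s)) 0).toLinearMap ∘ₗ monoSection r s hr = LinearMap.id := by
    refine linearMap_eq_of_mono r s hr fun i j k => ?_
    rw [LinearMap.comp_apply, monoSection_mono]
    simp only [AlgHom.toLinearMap_apply, map_mul, map_pow, freeW, map_add, map_smul]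
    rfl
  exact LinearMap.congr_fun this a

theorem monoSection_u (hr : r ≠ 0) : monoSection r s hr 𝐮 = FreeAlgebra.ι K Gen.u := by
  have h := monoSection_mono r s hr (1, 0, 0)
  simpa [mono] using h

theorem monoSection_d (hr : r ≠ 0) : monoSection r s hr 𝐝 = FreeAlgebra.ι K Gen.d := by
  have h := monoSection_mono r s hr (0, 0, 1)
  simpa [mono] using h

/-- With the second summand shifted by 2m, the operators of u, d and the lift of w are homogeneous,
hence so are those of the lifted monomials. -/
theorem deformation_monoSection_mem (hr : r ≠ 0) (m : ℕ) {n p : ℤ} {a : A} (ha : a ∈ comp n p) :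
    deformation (deformD r s hr m) (monoSection r s hr a)
      ∈ homogOps (r + s) (-(r * s)) (2 * m) n p := by
  have hu : deformation (deformD r s hr m) (FreeAlgebra.ι K Gen.u)
      ∈ homogOps (r + s) (-(r * s)) (2 * m) 1 1 := by
    rw [deformation_u]
    exact deformedMul_mem_homogOps u_mem_component fun _ _ _ _ => Submodule.zero_mem _
  have hd : deformation (deformD r s hr m) (FreeAlgebra.ι K Gen.d)
      ∈ homogOps (r + s) (-(r * s)) (2 * m) 1 (-1) := by
    rw [deformation_d]
    exact deformedMul_mem_homogOps d_mem_component fun _ _ _ hb =>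
      component_cast (deformD_mem r s hr m hb) rfl (by ring)
  have hw : deformation (deformD r s hr m) (freeW r s)
      ∈ homogOps (r + s) (-(r * s)) (2 * m) 2 0 := by
    rw [freeW, map_add, map_smul, map_smul, map_mul, map_mul]
    exact add_mem (Submodule.smul_mem _ _ (homogOps_cast (mul_mem_homogOps hu hd) (by norm_num)
        (by norm_num)))
      (Submodule.smul_mem _ _ (homogOps_cast (mul_mem_homogOps hd hu) (by norm_num)
        (by norm_num)))
  rw [component_eq_span r s hr] at ha
  induction ha using Submodule.span_induction with
  | mem x hx =>
    obtain ⟨⟨i, j, k⟩, ⟨rfl, rfl⟩, rfl⟩ := hx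
    rw [monoSection_mono, map_mul, map_mul, map_pow, map_pow, map_pow]
    exact homogOps_cast (mul_mem_homogOps (mul_mem_homogOps (pow_mem_homogOps hu _)
      (pow_mem_homogOps hw _)) (pow_mem_homogOps hd _))
      (by simp only [deg]; ring) (by simp only [sdeg]; ring)
  | zero => rw [map_zero, map_zero]; exact Submodule.zero_mem _
  | add x y _ _ hx hy => rw [map_add, map_add]; exact add_mem hx hy
  | smul t x _ hx => rw [map_smul, map_smul]; exact Submodule.smul_mem _ t hx

/-- A homogeneous Hochschild cocycle restricts to `D²U|wᵐ⁺¹d + DU²|uwᵐ⁺¹`. -/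
theorem exists_homogeneous_lift (hr : r ≠ 0) (m : ℕ) : ∃ f ∈ Z2 K A,
    restrict (r + s) (-(r * s)) f = cocycle (r + s) (-(r * s)) r 0 (m + 1) ∧
    ∀ p q p' q' : ℤ, ∀ a ∈ comp p q, ∀ b ∈ comp p' q',
      f a b ∈ comp (p + p' + 2 * m) (q + q' + 0) := by
  have hrel := deformation_rel (deformD_ddu r s hr m) (deformD_duu r s hr m)
  refine ⟨deformationCochain (deformD r s hr m) (monoSection r s hr),
    deformationCochain_mem_Z2 (proj_monoSection r s hr) hrel, ?_, ?_⟩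
  · have h1 := deformD_ddu r s hr m 1
    have h2 := deformD_duu r s hr m 1
    simp only [mul_one] at h1 h2
    rw [restrict_deformationCochain (proj_monoSection r s hr) hrel (monoSection_u r s hr)
      (monoSection_d r s hr) h1 h2]
    simp [cocycle]
  · intro p q p' q' a ha b hb
    have h1 : ((1 : A), (0 : A)) ∈ (comp 0 0).prod (comp (0 + 2 * m) 0) :=
      ⟨one_mem_component, Submodule.zero_mem _⟩
    have h2 := mul_mem_homogOps (deformation_monoSection_mem r s hr m ha)
      (deformation_monoSection_mem r s hr m hb) 0 0 _ h1
    have h3 := deformation_monoSection_mem r s hr m (mul_mem_component ha hb) 0 0 _ h1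
    rw [deformationCochain_apply, map_mul]
    exact Submodule.sub_mem _ (component_cast h2.2 (by ring) (by ring))
      (component_cast h3.2 (by ring) (by ring))

section
variable {α β : K}

theorem restrict_mem_C2component {f : Cochain2 K (Alg α β 0)} {n p : ℤ}
    (hf : ∀ n₁ p₁ n₂ p₂ : ℤ, ∀ a ∈ component α β n₁ p₁, ∀ b ∈ component α β n₂ p₂,
      f a b ∈ component α β (n₁ + n₂ + n) (p₁ + p₂ + p)) :
    restrict α β f ∈ C2component α β n p := by
  have hu := u_mem_component (α := α) (β := β)
  have hd := d_mem_component (α := α) (β := β)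
  have key1 : ∀ {x y z : Alg α β 0} {a b c N P : ℤ}, x ∈ component α β 1 a →
      y ∈ component α β 1 b → z ∈ component α β 1 c → n + 3 = N → a + b + c + p = P →
      f x (y * z) + x * f y z ∈ component α β N P := by
    intro x y z a b c N P hx hy hz hN hP
    exact add_mem
      (component_cast (hf _ _ _ _ _ hx _ (mul_mem_component hy hz)) (by omega) (by omega))
      (component_cast (mul_mem_component hx (hf _ _ _ _ _ hy _ hz)) (by omega) (by omega))
  exact ⟨Submodule.sub_mem _ (Submodule.sub_mem _ (key1 hd hd hu rfl (by ring))
      (Submodule.smul_mem _ _ (key1 hd hu hd rfl (by ring))))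
      (Submodule.smul_mem _ _ (key1 hu hd hd rfl (by ring))),
    Submodule.sub_mem _ (Submodule.sub_mem _ (key1 hd hu hu rfl (by ring))
      (Submodule.smul_mem _ _ (key1 hu hd hu rfl (by ring))))
      (Submodule.smul_mem _ _ (key1 hu hu hd rfl (by ring)))⟩

end

theorem comparison_mem_H2component {α β : K} {n p : ℤ} {c : HH2 K (Alg α β 0)}
    (hc : c ∈ HH2component α β n p) : comparison α β c ∈ H2component α β n p := by
  obtain ⟨f, hf, rfl⟩ := hc
  exact ⟨⟨restrict α β f.1, restrict_mem_ker α β f.1 f.2⟩, restrict_mem_C2component hf, rfl⟩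

variable {r s}

theorem H2component_eq_span (hr : r ≠ 0) (hs : s ≠ 0)
    (hgen : ∀ i j : ℤ, (i, j) ≠ (0, 0) → r ^ i * s ^ j ≠ 1) {k : ℕ} (hk : 1 ≤ k)
    (h : cocycle (r + s) (-(r * s)) r 0 (k + 1) ∈ Z (r + s) (-(r * s))) :
    H2component (r + s) (-(r * s)) (2 * k) 0 =
      Submodule.span K {H2class (r + s) (-(r * s)) (cocycle (r + s) (-(r * s)) r 0 (k + 1)) h} := by
  apply le_antisymm
  · rintro _ ⟨⟨x, hxZ⟩, hx, rfl⟩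
    have hx' : x ∈ Zcomponent (r + s) (-(r * s)) (2 * k) 0 := ⟨hxZ, hx⟩
    have hsup : x ∈ LinearMap.range (d1 (r + s) (-(r * s)))
        ⊔ Submodule.span K {cocycle (r + s) (-(r * s)) r 0 (k + 1)} := by
      rw [Zcomponent_eq_span hr hs hgen] at hx'
      refine Submodule.span_le.2 ?_ hx'
      rintro _ ⟨a, ha, rfl⟩
      exact cocycle_mem_sup hr hs hgen hk ha
    obtain ⟨y, hy, z, hz, rfl⟩ := Submodule.mem_sup.1 hsup
    obtain ⟨t, rfl⟩ := Submodule.mem_span_singleton.1 hz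
    refine Submodule.mem_span_singleton.2 ⟨t, ?_⟩
    rw [H2class, ← Submodule.Quotient.mk_smul, Submodule.mkQ_apply, Submodule.Quotient.eq]
    change t • _ - (y + t • _) ∈ LinearMap.range _
    rw [sub_add_cancel_right]
    exact Submodule.neg_mem _ hy
  · rw [Submodule.span_singleton_le_iff_mem]
    exact ⟨⟨_, h⟩, cocycle_mem_C2component (a := 0) (by omega), rfl⟩

theorem H2class_cocycle_ne_zero (hr : r ≠ 0) (hs : s ≠ 0)
    (hgen : ∀ i j : ℤ, (i, j) ≠ (0, 0) → r ^ i * s ^ j ≠ 1) {k : ℕ} (hk : 1 ≤ k)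
    (h : cocycle (r + s) (-(r * s)) r 0 (k + 1) ∈ Z (r + s) (-(r * s))) :
    H2class (r + s) (-(r * s)) (cocycle (r + s) (-(r * s)) r 0 (k + 1)) h ≠ 0 := by
  intro h0
  rw [H2class, Submodule.Quotient.mk_eq_zero] at h0
  exact cocycle_notMem_range hr hs hgen hk h0

end

end DownUp

/-! ### Transfer of the one-dimensional component to `HH²`. -/

theorem proposition4p9 {K : Type*} [Field K] [CharZero K] (α β r₁ r₂ : K)
    (hsum : r₁ + r₂ = α) (hprod : r₁ * r₂ = -β) (hβ : β ≠ 0)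
    (hgen : ∀ i j : ℤ, (i, j) ≠ (0, 0) → r₁ ^ i * r₂ ^ j ≠ 1)
    (k : ℕ) (hk : 1 ≤ k) :
    -- the component of `Ker(d₂*)` of bidegree `(2k, 0)`
    DownUp.Zcomponent α β (2 * k) 0 =
        Submodule.span K {x | ∃ a : ℕ, a ≤ k + 1 ∧ x = DownUp.cocycle α β r₁ a (k + 1 - a)} ∧
    Module.finrank K (DownUp.Zcomponent α β (2 * k) 0) = k + 2 ∧
    -- the component of bidegree `(2k, 0)` of the cohomology of the complex
    ∃ h : DownUp.cocycle α β r₁ 0 (k + 1) ∈ DownUp.Z α β,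
      Module.finrank K (DownUp.H2component α β (2 * k) 0) = 1 ∧
      DownUp.H2component α β (2 * k) 0 =
        Submodule.span K {DownUp.H2class α β (DownUp.cocycle α β r₁ 0 (k + 1)) h} ∧
      -- exactly one Hochschild class corresponds to it, and generates that component of `HH²(A)`
      ∃ c : Hochschild.HH2 K (DownUp.Alg α β 0),
        (∀ c', DownUp.comparison α β c' =
            DownUp.H2class α β (DownUp.cocycle α β r₁ 0 (k + 1)) h ↔ c' = c) ∧
        Module.finrank K (DownUp.HH2component α β (2 * k) 0) = 1 ∧
        DownUp.HH2component α β (2 * k) 0 = Submodule.span K {c} := by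
  obtain rfl : β = -(r₁ * r₂) := by rw [hprod, neg_neg]
  subst hsum
  have hr : r₁ ≠ 0 := by rintro rfl; simp at hβ
  have hs : r₂ ≠ 0 := by rintro rfl; simp at hβ
  refine ⟨DownUp.Zcomponent_eq_span hr hs hgen k, DownUp.finrank_Zcomponent hr hs hgen k,
    DownUp.cocycle_mem_ker hr _ _, ?_⟩
  have h := DownUp.cocycle_mem_ker (s := r₂) hr 0 (k + 1)
  have hH := DownUp.H2component_eq_span hr hs hgen hk h
  have hne := DownUp.H2class_cocycle_ne_zero hr hs hgen hk h
  obtain ⟨f, hf, hres, hhom⟩ := DownUp.exists_homogeneous_lift r₁ r₂ hr k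
  let c : Hochschild.HH2 K (DownUp.Alg (r₁ + r₂) (-(r₁ * r₂)) 0) := Submodule.Quotient.mk ⟨f, hf⟩
  have hc : DownUp.comparison _ _ c = DownUp.H2class _ _ _ h :=
    congrArg Submodule.Quotient.mk (Subtype.ext hres)
  have hc0 : c ≠ 0 := by
    intro h0
    rw [h0, map_zero] at hc
    exact hne hc.symm
  have hHH : DownUp.HH2component (r₁ + r₂) (-(r₁ * r₂)) (2 * k) 0 = Submodule.span K {c} := by
    -- The comparison embeds this component into the line spanned by the image of c, so it is at
    -- most a line; homogeneity of f puts c in it.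
    apply le_antisymm
    · intro c' hc'
      have h1 := DownUp.comparison_mem_H2component hc'
      rw [hH] at h1
      obtain ⟨t, ht⟩ := Submodule.mem_span_singleton.1 h1
      refine Submodule.mem_span_singleton.2 ⟨t, DownUp.comparison_injective ?_⟩
      rw [map_smul, hc, ht]
    · rw [Submodule.span_singleton_le_iff_mem]
      exact ⟨⟨f, hf⟩, hhom, rfl⟩
  refine ⟨?_, hH, c, fun c' => ⟨fun h' => DownUp.comparison_injective (h'.trans hc.symm), ?_⟩, ?_,
    hHH⟩
  · rw [hH]
    exact finrank_span_singleton hne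
  · rintro rfl
    exact hc
  · rw [hHH]
    exact finrank_span_singleton hc0
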